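/- Let $0<m<n$ be integers with $n\ge 3$. *Affine symmetric group.* Let $\widetilde S_n$ be generated by $s_i$ ($i\in\mathbb Z/n\mathbb Z$) with relations $s_i^2=1$, $s_is_{i+1}s_i=s_{i+1}s_is_{i+1}$, and $s_is_j=s_js_i$ if $i-j\ne\pm1$; let $\ell$ be its length function. For $J\subsetneq\mathbb Z/n\mathbb Z$ let $d_J$ (resp. $u_J$) be the product of the $s_j$, $j\in J$, each used once, in an order in which $s_{j+1}$ stands to the left (resp. right) of $s_j$ whenever $j,j+1\in J$; the elements $d_J$ are called cyclically decreasing. Let $\mathrm{maxr}(w)$ (resp. $\mathrm{maxc}(w)$) be the largest $|J|$ for which $w=v\,d_J$ (resp. $w=v\,u_J$) with $\ell(w)=\ell(v)+|J|$. An element $w$ is *321-avoiding* if no reduced word of $w$ contains three consecutive letters $s_is_{i+1}s_i$, and *0-Grassmannian* if every nonempty reduced word of $w$ ends with $s_0$. Let $A_{(n-m,m)}$ be the set of 321-avoiding $w$ with $\mathrm{maxc}(w)\le m$ and $\mathrm{maxr}(w)\le n-m$, and $A^0_{(n-m,m)}$ the set of its 0-Grassmannian elements. The affine Stanley symmetric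 function is the formal power series $$F_w=\sum x_1^{\ell(w_1)}x_2^{\ell(w_2)}\cdots,$$ summed over all sequences $(w_1,w_2,\dots)$ of cyclically decreasing elements, almost all equal to $1$, with $w_1w_2\cdots=w$ and $\sum_i\ell(w_i)=\ell(w)$. *Cylindric shapes.* Let $P_{mn}$ be the set of partitions with at most $m$ parts, all at most $n-m$. For $\lambda\in P_{mn}$ and $r\in\mathbb Z$ let $\lambda[r]$ be the bi-infinite weakly decreasing sequence with $\lambda[r]_{i+r}=\lambda_i+r$ for $1\le i\le m$ and $\lambda[r]_{i+m}=\lambda[r]_i-(n-m)$ for all $i$. For $\lambda,\mu\in P_{mn}$ and an integer $d\ge0$, $\lambda/d/\mu$ is a *cylindric shape of type $(m,n)$* if $\mu[0]_i\le\lambda[d]_i$ for all $i$. Its diagram $D_{\lambda/d/\mu}$ is the set of classes $\langle i,j\rangle$ (row $i$, column $j$) in $\mathbb Z^2/(-m,n-m)\mathbb Z$ with $\mu[0]_i<j\le\lambda[d]_i$. The cylindric skew Schur function is $s_{\lambda/d/\mu}=\sum_T\prod_{k\ge1}x_k^{|T^{-1}(k)|}$, summed over all $T:D_{\lambda/d/\mu}\to\{1,2,\dots\}$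 with $T(\langle i,j\rangle)\le T(\langle i,j+1\rangle)$ and $T(\langle i,j\rangle)<T(\langle i+1,j\rangle)$ whenever the boxes involved lie in the diagram. *The map $\phi$.* If $\alpha$ is a weakly decreasing sequence with $\alpha_{i+m}=\alpha_i-(n-m)$, and there is $p$ with $\alpha_p+1-p\equiv i \pmod n$ and $\alpha_p<\alpha_{p-1}$, let $A_i\cdot\alpha$ be the sequence obtained from $\alpha$ by adding $1$ to $\alpha_j$ for all $j\equiv p\pmod m$; otherwise let $A_i\cdot\alpha=0$. For a reduced word $w=s_{i_1}\cdots s_{i_l}$ put $A_w=A_{i_1}\cdots A_{i_l}$. For $w\in A^0_{(n-m,m)}$ write $\phi(w)=\lambda/d/\emptyset$ if $A_w\cdot\emptyset[0]=\lambda[d]$. **Corollary 4.11.** Let $\lambda/d/\mu$ be a cylindric shape of type $(m,n)$. There is exactly one element $\phi^{-1}(\lambda/d/\emptyset)$ of $A^0_{(n-m,m)}$ which $\phi$ sends to $\lambda/d/\emptyset$, and exactly one element $\phi^{-1}(\mu/0/\emptyset)$ of $A^0_{(n-m,m)}$ which $\phi$ sends to $\mu/0/\emptyset$. The element $$w=\phi^{-1}(\lambda/d/\emptyset)\,\phi^{-1}(\mu/0/\emptyset)^{-1}$$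 lies in $A_{(n-m,m)}$, and $$s_{\lambda/d/\mu}=F_w .$$ -/

import Mathlib

noncomputable section

namespace CylSchur

/-! ## The affine symmetric group -/

/-- The Coxeter matrix of affine type `A` with nodes `ℤ/nℤ` (for `3 ≤ n`): the generators `s_i` and
`s_j` satisfy the braid relation if `i - j = ±1`, and commute if `i - j ≠ 0, ±1`. -/
def affineMatrix (n : ℕ) : CoxeterMatrix (ZMod n) where
  M := Matrix.of fun i j : ZMod n =>
    if i = j then 1 else if i = j + 1 ∨ j = i + 1 then 3 else 2
  isSymm := by
    ext i j
    simp only [Matrix.transpose_apply, Matrix.of_apply, eq_comm (a := j) (b := i)]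
    congr 1
    simp only [or_comm]
  diagonal := by intro i; simp
  off_diagonal := by
    intro i j h
    simp only [Matrix.of_apply, if_neg h]
    split_ifs <;> norm_num

/-- The affine symmetric group, with generators `s_i` (`i ∈ ℤ/nℤ`) and the Coxeter relations. -/
abbrev AffineSym (n : ℕ) : Type := (affineMatrix n).Group

/-- The Coxeter system `(AffineSym n, {s_i})`; it provides the length function `ℓ`, the product
`wordProd` of a word, and the notion `IsReduced` of a reduced word. -/
abbrev cox (n : ℕ) : CoxeterSystem (affineMatrix n) (AffineSym n) := (affineMatrix n).toCoxeterSystem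

variable {n : ℕ}

/-- `ω` is a reduced word of `w`. -/
def IsReducedWord (ω : List (ZMod n)) (w : AffineSym n) : Prop :=
  (cox n).IsReduced ω ∧ (cox n).wordProd ω = w

/-- `w` is `0`-Grassmannian: all (nonempty) reduced words of `w` end with `s_0`.
The identity is `0`-Grassmannian. -/
def IsZeroGrassmannian (w : AffineSym n) : Prop :=
  ∀ ω : List (ZMod n), IsReducedWord ω w → ∀ h : ω ≠ [], ω.getLast h = 0

/-- `w` is `321`-avoiding: no reduced word of `w` contains three consecutive letters
`s_i s_{i+1} s_i`. -/
def Is321Avoiding (w : AffineSym n) : Prop :=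
  ∀ ω : List (ZMod n), IsReducedWord ω w → ∀ i : ZMod n, ¬ [i, i + 1, i] <:+: ω

/-! ## Cyclically decreasing and increasing elements -/

/-- Each letter occurs at most once, and if `i` and `i + 1` both occur, then `i + 1` precedes `i`. -/
def IsCycDecWord (ω : List (ZMod n)) : Prop :=
  ω.Nodup ∧ ∀ i : ZMod n, i ∈ ω → i + 1 ∈ ω → ω.idxOf (i + 1) < ω.idxOf i

/-- Each letter occurs at most once, and if `i` and `i + 1` both occur, then `i` precedes `i + 1`. -/
def IsCycIncWord (ω : List (ZMod n)) : Prop :=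
  ω.Nodup ∧ ∀ i : ZMod n, i ∈ ω → i + 1 ∈ ω → ω.idxOf i < ω.idxOf (i + 1)

/-- `w = d_J`: `J` is a proper subset of `ℤ/nℤ`, and `w` is the cyclically decreasing element which
uses exactly the generators `s_j`, `j ∈ J`. -/
def IsD (J : Finset (ZMod n)) (w : AffineSym n) : Prop :=
  (∃ j, j ∉ J) ∧ ∃ ω : List (ZMod n), IsCycDecWord ω ∧ ω.toFinset = J ∧ (cox n).wordProd ω = w

/-- `w = u_J`: `J` is a proper subset of `ℤ/nℤ`, and `w` is the cyclically increasing element which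
uses exactly the generators `s_j`, `j ∈ J`. -/
def IsU (J : Finset (ZMod n)) (w : AffineSym n) : Prop :=
  (∃ j, j ∉ J) ∧ ∃ ω : List (ZMod n), IsCycIncWord ω ∧ ω.toFinset = J ∧ (cox n).wordProd ω = w

/-- `w` is a cyclically decreasing element. The identity is one (`J = ∅`). -/
def IsCycDec (w : AffineSym n) : Prop := ∃ J : Finset (ZMod n), IsD J w

/-- The size of a largest `J` such that `w = v d_J` with `ℓ(w) = ℓ(v) + ℓ(d_J)`. -/
def maxr (w : AffineSym n) : ℕ :=
  sSup {k | ∃ (J : Finset (ZMod n)) (v u : AffineSym n), J.card = k ∧ IsD J u ∧ w = v * u ∧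
    (cox n).length w = (cox n).length v + (cox n).length u}

/-- The size of a largest `J` such that `w = v u_J` with `ℓ(w) = ℓ(v) + ℓ(u_J)`. -/
def maxc (w : AffineSym n) : ℕ :=
  sSup {k | ∃ (J : Finset (ZMod n)) (v u : AffineSym n), J.card = k ∧ IsU J u ∧ w = v * u ∧
    (cox n).length w = (cox n).length v + (cox n).length u}

/-- The set `A_{(n-m,m)}` of `321`-avoiding elements with `maxc ≤ m` and `maxr ≤ n - m`. -/
def setA (m n : ℕ) : Set (AffineSym n) :=
  {w | Is321Avoiding w ∧ maxc w ≤ m ∧ maxr w ≤ n - m}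

/-- The set `A⁰_{(n-m,m)}` of `0`-Grassmannian elements of `A_{(n-m,m)}`. -/
def setA0 (m n : ℕ) : Set (AffineSym n) := {w | w ∈ setA m n ∧ IsZeroGrassmannian w}

/-! ## Affine Stanley symmetric functions -/

/-- `f` is a cyclically decreasing decomposition `w = f 0 * f 1 * f 2 * ⋯`: all but finitely many
`f i` are `1`, each `f i` is cyclically decreasing, and the lengths add up to the length of `w`.
-/
def IsCycDecDecomposition (w : AffineSym n) (f : ℕ → AffineSym n) : Prop :=
  (∀ i, IsCycDec (f i)) ∧ ∃ N : ℕ, (∀ i, N ≤ i → f i = 1) ∧ ((List.range N).map f).prod = w ∧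
    ∑ i ∈ Finset.range N, (cox n).length (f i) = (cox n).length w

/-- The affine Stanley symmetric function `F_w = ∑ x₁^{ℓ(w₁)} x₂^{ℓ(w₂)} ⋯`, the sum over the
cyclically decreasing decompositions of `w`. It is a formal power series; the variable with index
`k : ℕ` is `x_{k+1}`, and the coefficient of `x^a` is the (finite) number of decompositions with
`ℓ(f k) = a k` for all `k`. -/
def affineStanley (w : AffineSym n) : MvPowerSeries ℕ ℤ := fun a : ℕ →₀ ℕ =>
  (Nat.card {f : ℕ → AffineSym n //
    IsCycDecDecomposition w f ∧ ∀ k, (cox n).length (f k) = a k} : ℤ)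

/-! ## Cylindric shapes -/

/-- The set `P_{mn}` of partitions with at most `m` parts and largest part at most `n - m`.
`part i` is the part with number `i + 1`; missing parts are `0`. -/
structure BoxPartition (m n : ℕ) where
  part : ℕ → ℕ
  anti : Antitone part
  part_le : ∀ i, part i ≤ n - m
  part_eq_zero : ∀ i, m ≤ i → part i = 0

/-- The empty partition. -/
def BoxPartition.empty (m n : ℕ) : BoxPartition m n where
  part := fun _ => 0
  anti := fun _ _ _ => le_rfl
  part_le := fun _ => Nat.zero_le _
  part_eq_zero := fun _ _ => rfl

/-- The bi-infinite weakly decreasing sequence `λ[r]`, given by `λ[r]_{i+r} = λ_i + r` for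
`1 ≤ i ≤ m` and by `λ[r]_{i+m} = λ[r]_i - (n - m)` for all `i`. -/
def BoxPartition.shift {m n : ℕ} (lam : BoxPartition m n) (r : ℤ) : ℤ → ℤ := fun i =>
  (lam.part ((i - r - 1) % m).toNat : ℤ) + r - ((i - r - 1) / m) * ((n : ℤ) - m)

/-- `A_i · α = β` (so in particular `A_i · α ≠ 0`): a box on the `i`-th diagonal can be added to
row `p` of `α`, and adding it (in all rows congruent to `p` modulo `m`) gives `β`. -/
def AddsBox (m : ℕ) {n : ℕ} (i : ZMod n) (α β : ℤ → ℤ) : Prop :=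
  ∃ p : ℤ, ((α p + 1 - p : ℤ) : ZMod n) = i ∧ α p < α (p - 1) ∧
    β = fun j => if j ≡ p [ZMOD m] then α j + 1 else α j

/-- `A_{i_1} ⋯ A_{i_l} · α = β` (nonzero) for the word `ω = i_1 ⋯ i_l`; the last letter acts
first. -/
def WordActs (m : ℕ) {n : ℕ} : List (ZMod n) → (ℤ → ℤ) → (ℤ → ℤ) → Prop
  | [], α, β => α = β
  | i :: ω, α, β => ∃ γ, WordActs m ω α γ ∧ AddsBox m i γ β

/-- `A_w · α = β` (nonzero), where `A_w = A_{i_1} ⋯ A_{i_l}` for a reduced word of `w`. -/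
def NilActs (m : ℕ) {n : ℕ} (w : AffineSym n) (α β : ℤ → ℤ) : Prop :=
  ∃ ω : List (ZMod n), IsReducedWord ω w ∧ WordActs m ω α β

/-- `w ∈ A⁰_{(n-m,m)}` and `φ(w) = λ/d/∅`, where `φ(w) = A_w · (∅/0/∅)`. -/
def IsPhiPreimage {m n : ℕ} (w : AffineSym n) (lam : BoxPartition m n) (d : ℕ) : Prop :=
  w ∈ setA0 m n ∧ NilActs m w ((BoxPartition.empty m n).shift 0) (lam.shift d)

/-! ## Cylindric skew Schur functions -/

/-- The cylinder: boxes `(i, j)` (row `i`, column `j`) modulo the shift by `(-m, n - m)`. -/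
abbrev Cyl (m n : ℕ) : Type :=
  (ℤ × ℤ) ⧸ AddSubgroup.zmultiples ((-(m : ℤ), (n : ℤ) - m) : ℤ × ℤ)

/-- The class `⟨i, j⟩` of a box in the cylinder. -/
def box (m n : ℕ) (i j : ℤ) : Cyl m n := QuotientAddGroup.mk (i, j)

/-- The cylindric diagram `{⟨i, j⟩ | β_i < j ≤ α_i}` between two sequences. -/
def diagram (m n : ℕ) (α β : ℤ → ℤ) : Set (Cyl m n) :=
  {c | ∃ i j : ℤ, c = box m n i j ∧ β i < j ∧ j ≤ α i}

/-- Semistandard: entries increase weakly along rows and strictly down columns. -/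
def IsSemistandard {m n : ℕ} (D : Set (Cyl m n)) (T : D → ℕ) : Prop :=
  (∀ (i j : ℤ) (h : box m n i j ∈ D) (h' : box m n i (j + 1) ∈ D), T ⟨_, h⟩ ≤ T ⟨_, h'⟩) ∧
  (∀ (i j : ℤ) (h : box m n i j ∈ D) (h' : box m n (i + 1) j ∈ D), T ⟨_, h⟩ < T ⟨_, h'⟩)

/-- The generating function `∑_T x^{w(T)}` of the semistandard tableaux on the cylindric diagram
`{⟨i, j⟩ | β_i < j ≤ α_i}`. The entry `k : ℕ` of a tableau stands for the entry `k + 1`, with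
variable `x_{k+1}`; the coefficient of `x^a` is the (finite) number of tableaux in which each `k`
occurs `a k` times. -/
def tableauxSeries (m n : ℕ) (α β : ℤ → ℤ) : MvPowerSeries ℕ ℤ := fun a : ℕ →₀ ℕ =>
  (Nat.card {T : diagram m n α β → ℕ //
    IsSemistandard (diagram m n α β) T ∧ ∀ k, Nat.card {c // T c = k} = a k} : ℤ)

/-- The cylindric skew Schur function `s_{λ/d/μ}`, for the cylindric shape
`λ/d/μ = λ[d]/μ[0]`. -/
def cylSchur {m n : ℕ} (lam : BoxPartition m n) (d : ℕ) (mu : BoxPartition m n) :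
    MvPowerSeries ℕ ℤ :=
  tableauxSeries m n (lam.shift d) (mu.shift 0)

end CylSchur

end

/-!
A weakly decreasing sequence `α` with `α_{i+m} = α_i - (n - m)` is encoded by beads on the
integers at the positions `α_p - p`; they are distinct, and occupy exactly `m` residues modulo
`n`. Adding a box on the diagonal `i` moves the beads on residue `i - 1` to residue `i`, which has
to be free, and this is the effect of the simple reflection `s_i` in the usual action of the
affine symmetric group on `ℤ`.

The total displacement of the beads of one period under a group element is at most its length,
as a single letter moves at most one of them forward (`sum_affPerm_le`). Words which add boxes
attain this bound. Hence they are reduced (`WordActs.isReduced`), and every other reduced word of the same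
element attains the bound too, which forces each of its letters to add a box
(`WordActs.of_isReduced`). So whether a reduced word acts without giving zero depends on the group
element only. Conversely, all words which add the boxes of `β / α` to `α` represent the same element
(`WordActs.wordProd_eq`): boxes which can be added to the same sequence lie on diagonals whose
reflections commute, and induction applies. This gives existence and uniqueness of the
preimages under `φ`, and shows that `w = φ⁻¹(λ/d/∅) φ⁻¹(μ/0/∅)⁻¹` is the element which acts from
`μ[0]` to `λ[d]`. That `w` lies in `A_{(n-m,m)}` is read off from the action of its reduced words
on the beads (`NilActs.mem_setA`).

The action of a cyclically decreasing element adds a horizontal strip, and each horizontal strip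
is added by exactly one such element (`WordActs.strip`, `Strip.exists_wordActs`). Thus cyclically
decreasing decompositions of `w` correspond to chains of horizontal strips from `μ[0]` to `λ[d]`
(`card_decompositions`), and so do tableaux (`card_tableaux`), but with the sizes of the strips in
the opposite order. The two numbers agree since the number of chains does not depend on the order
of the sizes (`card_stripChains_comp`). This is the Bender–Knuth involution: for horizontal
strips `γ / α` and `β / γ`, the entries of `γ` range independently of each other over intervals
given by `α` and `β`, and reflecting every entry in its interval exchanges the two sizes.
-/

namespace CylSchur

variable {m n : ℕ}

/-! ### The action of the affine symmetric group on the integers -/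

/-- The action of the simple reflection `s_i` on `ℤ`: it exchanges `x - 1` and `x` for all
`x ≡ i` modulo `n`. -/
def affRefl (i : ZMod n) (x : ℤ) : ℤ :=
  if (x : ZMod n) = i then x - 1 else if (x : ZMod n) + 1 = i then x + 1 else x

lemma zmod_one_ne_zero (hn : 3 ≤ n) : (1 : ZMod n) ≠ 0 := by
  have : Fact (1 < n) := ⟨by omega⟩
  exact one_ne_zero

lemma zmod_two_ne_zero (hn : 3 ≤ n) : (1 : ZMod n) + 1 ≠ 0 := by
  intro h
  have h2 : ((2 : ℕ) : ZMod n) = 0 := by push_cast; rw [← h]; norm_num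
  rw [ZMod.natCast_eq_zero_iff] at h2
  exact absurd (Nat.le_of_dvd (by norm_num) h2) (by omega)

lemma affRefl_cast (hn : 3 ≤ n) (i : ZMod n) (x : ℤ) :
    ((affRefl i x : ℤ) : ZMod n) = Equiv.swap (i - 1) i (x : ZMod n) := by
  have h1 := zmod_one_ne_zero hn
  unfold affRefl
  split_ifs with h h'
  · simp [h]
  · push_cast
    rw [← h']
    simp
  · rw [Equiv.swap_apply_of_ne_of_ne _ h]
    intro h2; apply h'; rw [h2]; ring

/-- The three cases in the definition of `affRefl`, with the residues of the images. -/
lemma affRefl_cases (i : ZMod n) (x : ℤ) :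
    ((x : ZMod n) = i ∧ affRefl i x = x - 1 ∧ ((x - 1 : ℤ) : ZMod n) = i - 1) ∨
    ((x : ZMod n) ≠ i ∧ (x : ZMod n) + 1 = i ∧ affRefl i x = x + 1 ∧
      ((x + 1 : ℤ) : ZMod n) = i) ∨
    ((x : ZMod n) ≠ i ∧ (x : ZMod n) + 1 ≠ i ∧ affRefl i x = x) := by
  unfold affRefl
  split_ifs with h h'
  · left; simp [h]
  · right; left; simp [h, h']
  · right; right; simp [h, h']

lemma affRefl_involutive (hn : 3 ≤ n) (i : ZMod n) : Function.Involutive (affRefl i) := by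
  have h1 := zmod_one_ne_zero hn
  intro x
  rcases affRefl_cases i x with h | h | h
  · have := affRefl_cases i (x - 1); grind
  · have := affRefl_cases i (x + 1); grind
  · grind

lemma affRefl_comm {i j : ZMod n} (hij : i ≠ j) (h1 : i ≠ j + 1) (h2 : j ≠ i + 1) (x : ℤ) :
    affRefl i (affRefl j x) = affRefl j (affRefl i x) := by
  have fix : ∀ (k : ZMod n) (y : ℤ), (y : ZMod n) ≠ k → (y : ZMod n) + 1 ≠ k → affRefl k y = y :=
    fun k y h h' => by simp [affRefl, h, h']
  rcases affRefl_cases i x with ⟨h, e, c⟩ | ⟨-, h, e, c⟩ | ⟨h, h', e⟩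
  · rw [e, fix j x (by grind) (by grind), fix j (x - 1) (by grind) (by grind), e]
  · rw [e, fix j x (by grind) (by grind), fix j (x + 1) (by grind) (by grind), e]
  · rw [e]
    rcases affRefl_cases j x with ⟨h, e, c⟩ | ⟨-, h, e, c⟩ | ⟨h, h', e⟩
    · rw [e, fix i (x - 1) (by grind) (by grind)]
    · rw [e, fix i (x + 1) (by grind) (by grind)]
    · rwa [e]

lemma affRefl_braid (hn : 3 ≤ n) (i : ZMod n) (x : ℤ) :
    affRefl i (affRefl (i + 1) (affRefl i x)) =
      affRefl (i + 1) (affRefl i (affRefl (i + 1) x)) := by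
  have h1 := zmod_one_ne_zero hn
  have h2 := zmod_two_ne_zero hn
  have key : ∀ y : ℤ, ((y : ZMod n) = i → affRefl i y = y - 1 ∧ affRefl (i + 1) y = y + 1) ∧
      ((y : ZMod n) = i - 1 → affRefl i y = y + 1 ∧ affRefl (i + 1) y = y) ∧
      ((y : ZMod n) = i + 1 → affRefl i y = y ∧ affRefl (i + 1) y = y - 1) ∧
      ((y : ZMod n) ≠ i → (y : ZMod n) ≠ i - 1 → (y : ZMod n) ≠ i + 1 →
        affRefl i y = y ∧ affRefl (i + 1) y = y) := by
    intro y
    have := affRefl_cases i y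
    have := affRefl_cases (i + 1) y
    refine ⟨?_, ?_, ?_, ?_⟩ <;> intros <;> grind
  have c1 : ∀ y : ℤ, ((y - 1 : ℤ) : ZMod n) = (y : ZMod n) - 1 := by simp
  have c2 : ∀ y : ℤ, ((y + 1 : ℤ) : ZMod n) = (y : ZMod n) + 1 := by simp
  by_cases e1 : (x : ZMod n) = i
  · rw [((key x).1 e1).1, ((key x).1 e1).2, ((key (x - 1)).2.1 (by rw [c1, e1])).2,
      ((key (x - 1)).2.1 (by rw [c1, e1])).1, ((key (x + 1)).2.2.1 (by rw [c2, e1])).1,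
      ((key (x + 1)).2.2.1 (by rw [c2, e1])).2]
    ring
  by_cases e2 : (x : ZMod n) = i - 1
  · rw [((key x).2.1 e2).1, ((key x).2.1 e2).2,
      ((key (x + 1)).1 (by rw [c2, e2]; ring)).2, ((key x).2.1 e2).1,
      ((key (x + 1)).1 (by rw [c2, e2]; ring)).2,
      ((key (x + 1 + 1)).2.2.1 (by rw [c2, c2, e2]; ring)).1]
  by_cases e3 : (x : ZMod n) = i + 1
  · rw [((key x).2.2.1 e3).1, ((key x).2.2.1 e3).2,
      ((key (x - 1)).1 (by rw [c1, e3]; ring)).1,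
      ((key (x - 1 - 1)).2.1 (by rw [c1, c1, e3]; ring)).2]
  · rw [((key x).2.2.2 e1 e2 e3).1, ((key x).2.2.2 e1 e2 e3).2, ((key x).2.2.2 e1 e2 e3).1,
      ((key x).2.2.2 e1 e2 e3).2]

/-- The permutation `affRefl i` of `ℤ`. -/
def affReflPerm (hn : 3 ≤ n) (i : ZMod n) : Equiv.Perm ℤ := (affRefl_involutive hn i).toPerm

lemma affReflPerm_sq (hn : 3 ≤ n) (i : ZMod n) : affReflPerm hn i * affReflPerm hn i = 1 :=
  Equiv.ext (affRefl_involutive hn i)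

lemma affReflPerm_braid (hn : 3 ≤ n) (i : ZMod n) :
    affReflPerm hn i * affReflPerm hn (i + 1) * affReflPerm hn i =
      affReflPerm hn (i + 1) * affReflPerm hn i * affReflPerm hn (i + 1) :=
  Equiv.ext (affRefl_braid hn i)

lemma affReflPerm_liftable (hn : 3 ≤ n) :
    (affineMatrix n).IsLiftable (affReflPerm hn) := by
  have braid : ∀ {G : Type} [Group G] (a b : G), a * a = 1 → b * b = 1 →
      a * b * a = b * a * b → (a * b) ^ 3 = 1 := by
    intro G _ a b ha hb h
    calc (a * b) ^ 3 = (a * b * a) * (b * a * b) := by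
          simp only [pow_succ, pow_zero, one_mul, mul_assoc]
      _ = 1 := by rw [h]; calc
          b * a * b * (b * a * b) = b * a * (b * b) * a * b := by simp only [mul_assoc]
          _ = b * (a * a) * b := by rw [hb]; simp only [mul_assoc, one_mul]
          _ = 1 := by rw [ha, mul_one, hb]
  intro i j
  change _ ^ (if i = j then 1 else if i = j + 1 ∨ j = i + 1 then 3 else 2) = _
  split_ifs with h1 h2
  · rw [h1, pow_one, affReflPerm_sq]
  · rcases h2 with rfl | rfl
    · exact braid _ _ (affReflPerm_sq _ _) (affReflPerm_sq _ _) (affReflPerm_braid hn j).symm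
    · exact braid _ _ (affReflPerm_sq _ _) (affReflPerm_sq _ _) (affReflPerm_braid hn i)
  · push Not at h2
    have hc : affReflPerm hn i * affReflPerm hn j = affReflPerm hn j * affReflPerm hn i :=
      Equiv.ext (affRefl_comm h1 h2.1 h2.2)
    rw [pow_two, mul_assoc, ← mul_assoc (affReflPerm hn j), ← hc, mul_assoc, affReflPerm_sq,
      mul_one, affReflPerm_sq]

/-- The action of the affine symmetric group on `ℤ`. -/
def affPerm (hn : 3 ≤ n) : AffineSym n →* Equiv.Perm ℤ :=
  (cox n).lift ⟨affReflPerm hn, affReflPerm_liftable hn⟩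

lemma affPerm_cons (hn : 3 ≤ n) (i : ZMod n) (ω : List (ZMod n)) (x : ℤ) :
    affPerm hn ((cox n).wordProd (i :: ω)) x =
      affRefl i (affPerm hn ((cox n).wordProd ω) x) := by
  rw [CoxeterSystem.wordProd_cons, map_mul, affPerm, CoxeterSystem.lift_apply_simple]
  rfl

lemma affPerm_nil (hn : 3 ≤ n) (x : ℤ) : affPerm hn ((cox n).wordProd []) x = x := by
  simp

/-! ### Displacement of beads and reduced words -/

section Energy
variable {ι : Type*}

lemma affRefl_injOn (hn : 3 ≤ n) (i : ZMod n) {s : Set ι} {e : ι → ℤ}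
    (he : s.InjOn fun x => (e x : ZMod n)) : s.InjOn fun x => (affRefl i (e x) : ZMod n) := by
  intro x hx y hy h
  simp only [affRefl_cast hn] at h
  exact he hx hy (Equiv.injective _ h)

lemma affRefl_sub_le (i : ZMod n) (x : ℤ) :
    affRefl i x - x ≤ if (x : ZMod n) + 1 = i then 1 else 0 := by
  unfold affRefl; split_ifs <;> simp

/-- A simple reflection moves at most one of finitely many beads with distinct residues forward. -/
lemma sum_affRefl_sub_le {s : Finset ι} {e : ι → ℤ} (i : ZMod n)
    (he : (s : Set ι).InjOn fun x => (e x : ZMod n)) :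
    ∑ x ∈ s, (affRefl i (e x) - e x) ≤ 1 := by
  refine (Finset.sum_le_sum fun x _ => affRefl_sub_le i (e x)).trans ?_
  rw [Finset.sum_boole]
  norm_cast
  rw [Finset.card_le_one]
  intro a ha b hb
  simp only [Finset.mem_filter] at ha hb
  refine he ha.1 hb.1 ?_
  have := ha.2.trans hb.2.symm
  simpa using this

/-- If the displacement is maximal, there is a bead on residue `i - 1` and none on residue `i`. -/
lemma exists_of_sum_affRefl_sub {s : Finset ι} {e : ι → ℤ} {i : ZMod n}
    (he : (s : Set ι).InjOn fun x => (e x : ZMod n))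
    (h : ∑ x ∈ s, (affRefl i (e x) - e x) = 1) :
    (∃ x ∈ s, (e x : ZMod n) + 1 = i) ∧ ∀ x ∈ s, (e x : ZMod n) ≠ i := by
  classical
  constructor
  · by_contra! hc
    have : ∑ x ∈ s, (affRefl i (e x) - e x) ≤ 0 := Finset.sum_nonpos fun x hx => by
      have := affRefl_sub_le i (e x)
      rwa [if_neg (hc x hx)] at this
    omega
  · intro x hx hi
    rw [← Finset.add_sum_erase _ _ hx] at h
    have h2 := sum_affRefl_sub_le (s := s.erase x) i (he.mono (by simp))
    rw [affRefl, if_pos hi] at h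
    omega

lemma sum_affRefl_sub_eq_one {s : Finset ι} {e : ι → ℤ} {i : ZMod n}
    (he : (s : Set ι).InjOn fun x => (e x : ZMod n))
    (h1 : ∃ x ∈ s, (e x : ZMod n) + 1 = i) (h2 : ∀ x ∈ s, (e x : ZMod n) ≠ i) :
    ∑ x ∈ s, (affRefl i (e x) - e x) = 1 := by
  obtain ⟨x, hx, hxi⟩ := h1
  rw [Finset.sum_eq_single_of_mem x hx]
  · simp [affRefl, h2 x hx, hxi]
  · intro y hy hyx
    have : (e y : ZMod n) + 1 ≠ i := fun h => hyx (he hy hx (by simpa using h.trans hxi.symm))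
    simp [affRefl, h2 y hy, this]

lemma affPerm_injOn (hn : 3 ≤ n) {s : Set ι} {e : ι → ℤ}
    (he : s.InjOn fun x => (e x : ZMod n)) (ω : List (ZMod n)) :
    s.InjOn fun x => (affPerm hn ((cox n).wordProd ω) (e x) : ZMod n) := by
  induction ω with
  | nil => simpa using he
  | cons i ω ih => simpa only [affPerm_cons] using affRefl_injOn hn i ih

lemma sum_affPerm_cons (hn : 3 ≤ n) (s : Finset ι) (e : ι → ℤ) (i : ZMod n)
    (ω : List (ZMod n)) :
    ∑ x ∈ s, (affPerm hn ((cox n).wordProd (i :: ω)) (e x) - e x) =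
      ∑ x ∈ s, (affRefl i (affPerm hn ((cox n).wordProd ω) (e x)) -
        affPerm hn ((cox n).wordProd ω) (e x)) +
      ∑ x ∈ s, (affPerm hn ((cox n).wordProd ω) (e x) - e x) := by
  rw [← Finset.sum_add_distrib]
  exact Finset.sum_congr rfl fun x _ => by rw [affPerm_cons]; ring

/-- The total displacement of a set of beads with distinct residues is at most the number of
letters of the word which moves them. -/
lemma sum_affPerm_le (hn : 3 ≤ n) {s : Finset ι} {e : ι → ℤ}
    (he : (s : Set ι).InjOn fun x => (e x : ZMod n)) (ω : List (ZMod n)) :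
    ∑ x ∈ s, (affPerm hn ((cox n).wordProd ω) (e x) - e x) ≤ ω.length := by
  induction ω with
  | nil => simp
  | cons i ω ih =>
    rw [sum_affPerm_cons]
    have := sum_affRefl_sub_le i (affPerm_injOn hn he ω)
    rw [List.length_cons]
    push_cast
    linarith

/-- A word which moves a set of beads with distinct residues by as much as its number of letters
is reduced. -/
lemma isReduced_of_sum_affPerm (hn : 3 ≤ n) {s : Finset ι} {e : ι → ℤ}
    (he : (s : Set ι).InjOn fun x => (e x : ZMod n)) {ω : List (ZMod n)}
    (h : ∑ x ∈ s, (affPerm hn ((cox n).wordProd ω) (e x) - e x) = ω.length) :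
    (cox n).IsReduced ω := by
  obtain ⟨ω', h1, h2⟩ := (cox n).exists_isReduced ((cox n).wordProd ω)
  have h3 := sum_affPerm_le hn he ω'
  rw [← h2, h] at h3
  refine le_antisymm ((cox n).length_wordProd_le ω) ?_
  rw [h2, h1.eq]
  exact_mod_cast h3

end Energy

/-! ### Cylindric sequences, their beads, and words which add boxes -/

/-- The bi-infinite weakly decreasing sequences `α` with `α_{i+m} = α_i - (n - m)`. -/
structure IsCyl (m n : ℕ) (α : ℤ → ℤ) : Prop where
  anti : Antitone α
  period : ∀ i, α (i + m) = α i - ((n : ℤ) - m)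

/-- The position `α_p - p` of the bead which encodes row `p` of `α`. -/
def bead (α : ℤ → ℤ) (p : ℤ) : ℤ := α p - p

/-- The sum of `α` over one period, with rows `0, …, m - 1` as representatives. The number of boxes
of a cylindric shape is a difference of such sums. -/
def size (m : ℕ) (α : ℤ → ℤ) : ℤ := ∑ p ∈ Finset.range m, α p

lemma IsCyl.add_mul {α : ℤ → ℤ} (h : IsCyl m n α) (i k : ℤ) :
    α (i + k * m) = α i - k * ((n : ℤ) - m) := by
  induction k using Int.induction_on with
  | zero => simp
  | succ k ih =>
    rw [_root_.add_mul, one_mul, ← add_assoc, h.period, ih]; ring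
  | pred k ih =>
    have := h.period (i + (-k - 1) * m)
    rw [show i + (-(k : ℤ) - 1) * m + m = i + -k * m by ring, ih] at this
    linarith

lemma IsCyl.bead_add_mul {α : ℤ → ℤ} (h : IsCyl m n α) (p k : ℤ) :
    bead α (p + k * m) = bead α p - k * n := by
  rw [bead, bead, h.add_mul]; ring

lemma IsCyl.bead_strictAnti {α : ℤ → ℤ} (h : IsCyl m n α) : StrictAnti (bead α) := by
  intro p q hpq
  have := h.anti hpq.le
  unfold bead
  omega

lemma IsCyl.bead_cast_congr {α : ℤ → ℤ} (h : IsCyl m n α) {p q : ℤ} (hpq : p ≡ q [ZMOD m]) :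
    (bead α p : ZMod n) = bead α q := by
  obtain ⟨k, hk⟩ := hpq.dvd
  rw [show q = p + k * m by linarith, h.bead_add_mul]
  simp

lemma IsCyl.exists_bead_eq {α : ℤ → ℤ} (h : IsCyl m n α) {p x : ℤ}
    (hx : (bead α p : ZMod n) = x) : ∃ q, q ≡ p [ZMOD m] ∧ bead α q = x := by
  rw [ZMod.intCast_eq_intCast_iff_dvd_sub] at hx
  obtain ⟨k, hk⟩ := hx
  refine ⟨p + (-k) * m, ?_, ?_⟩
  · exact (Int.modEq_iff_dvd.2 ⟨k, by ring⟩)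
  · rw [h.bead_add_mul]; linarith

lemma IsCyl.bead_cast_eq_iff {α : ℤ → ℤ} (h : IsCyl m n α) {p q : ℤ} :
    (bead α p : ZMod n) = bead α q ↔ p ≡ q [ZMOD m] := by
  refine ⟨fun hpq => ?_, h.bead_cast_congr⟩
  obtain ⟨r, hr, he⟩ := h.exists_bead_eq hpq
  rw [h.bead_strictAnti.injective he] at hr
  exact hr.symm

lemma exists_range_modEq (hm : 0 < m) (p : ℤ) : ∃ q ∈ Finset.range m, (q : ℤ) ≡ p [ZMOD m] := by
  have h0 : (m : ℤ) ≠ 0 := by omega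
  have h1 := Int.emod_nonneg p h0
  have h2 := Int.emod_lt_of_pos p (show (0 : ℤ) < m by omega)
  refine ⟨(p % m).toNat, by rw [Finset.mem_range]; omega, ?_⟩
  rw [Int.toNat_of_nonneg h1]
  exact Int.mod_modEq p m

lemma range_modEq_injective {a b : ℕ} (ha : a ∈ Finset.range m) (hb : b ∈ Finset.range m)
    (h : (a : ℤ) ≡ b [ZMOD m]) : a = b := by
  rw [Int.natCast_modEq_iff] at h
  exact h.eq_of_lt_of_lt (Finset.mem_range.1 ha) (Finset.mem_range.1 hb)

lemma IsCyl.bead_injOn {α : ℤ → ℤ} (h : IsCyl m n α) :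
    ((Finset.range m : Finset ℕ) : Set ℕ).InjOn fun p : ℕ => (bead α p : ZMod n) :=
  fun _ hp _ hq he => range_modEq_injective hp hq (h.bead_cast_eq_iff.1 he)

/-- Pointwise comparable cylindric sequences with the same sum over one period are equal. -/
lemma IsCyl.eq_of_le_of_size {α β : ℤ → ℤ} (hm : 0 < m) (hα : IsCyl m n α) (hβ : IsCyl m n β)
    (h : ∀ i, α i ≤ β i) (hs : size m β ≤ size m α) : α = β := by
  have key : ∀ p ∈ Finset.range m, α (p : ℤ) = β p :=
    (Finset.sum_eq_sum_iff_of_le (s := Finset.range m) fun p _ => h (p : ℤ)).1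
      (le_antisymm (Finset.sum_le_sum fun p _ => h p) hs)
  funext i
  obtain ⟨q, hq, hqi⟩ := exists_range_modEq hm i
  obtain ⟨k, hk⟩ := hqi.dvd
  rw [show i = q + k * m by linarith, hα.add_mul, hβ.add_mul, key q hq]

/-- A box can be added on the diagonal `i` iff residue `i - 1` holds a bead and residue `i` does
not. -/
lemma IsCyl.lt_pred_iff {α : ℤ → ℤ} (h : IsCyl m n α) {p : ℤ} {i : ZMod n}
    (hi : (bead α p : ZMod n) + 1 = i) :
    α p < α (p - 1) ↔ ∀ q, (bead α q : ZMod n) ≠ i := by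
  constructor
  · rintro hlt q hq
    obtain ⟨r, -, hr⟩ := h.exists_bead_eq (p := q) (x := bead α p + 1) (by rw [hq, ← hi]; simp)
    have h1 : r < p := h.bead_strictAnti.lt_iff_gt.1 (by omega)
    have h2 := h.bead_strictAnti.antitone (show r ≤ p - 1 by omega)
    unfold bead at *
    omega
  · intro hq
    refine lt_of_le_of_ne (h.anti (by omega)) fun he => hq (p - 1) ?_
    rw [← hi]
    simp only [bead, he]
    push_cast
    ring

/-- The result of adding a box in each row congruent to `p` modulo `m`. -/
def addRow (m : ℕ) (α : ℤ → ℤ) (p : ℤ) : ℤ → ℤ := fun j => if j ≡ p [ZMOD m] then α j + 1 else α j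

lemma addsBox_iff {α β : ℤ → ℤ} (h : IsCyl m n α) {i : ZMod n} :
    AddsBox m i α β ↔ ∃ p, (bead α p : ZMod n) + 1 = i ∧ (∀ q, (bead α q : ZMod n) ≠ i) ∧
      β = addRow m α p := by
  have hc : ∀ p, (((α p + 1 - p : ℤ) : ZMod n) = i) = ((bead α p : ZMod n) + 1 = i) := by
    intro p
    congr 1
    unfold bead
    push_cast
    ring
  unfold AddsBox
  refine exists_congr fun p => ?_
  rw [hc]
  exact and_congr_right fun h1 => and_congr_left fun _ => h.lt_pred_iff h1

lemma IsCyl.addRow {α : ℤ → ℤ} (h : IsCyl m n α) {p : ℤ}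
    (hp : α p < α (p - 1)) : IsCyl m n (addRow m α p) := by
  constructor
  · refine antitone_int_of_succ_le fun j => ?_
    have h1 : α (j + 1) ≤ α j := h.anti (by omega)
    unfold CylSchur.addRow
    split_ifs with c1 c2 c2
    · omega
    · obtain ⟨k, hk⟩ := c1.dvd
      have e1 := h.add_mul (j + 1) k
      have e2 := h.add_mul j k
      rw [show j + 1 + k * m = p by linarith] at e1
      rw [show j + k * m = p - 1 by linarith] at e2
      omega
    · omega
    · exact h1
  · intro j
    have : (j + m ≡ p [ZMOD m]) ↔ (j ≡ p [ZMOD m]) := by simp [Int.ModEq]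
    unfold CylSchur.addRow
    simp only [this, h.period]
    split_ifs <;> ring

lemma size_addRow (hm : 0 < m) (α : ℤ → ℤ) (p : ℤ) : size m (addRow m α p) = size m α + 1 := by
  obtain ⟨q, hq, hqp⟩ := exists_range_modEq hm p
  have : size m (addRow m α p) - size m α = 1 := by
    unfold size
    rw [← Finset.sum_sub_distrib, Finset.sum_eq_single_of_mem q hq]
    · simp [addRow, hqp]
    · intro b hb hbq
      have : ¬ ((b : ℤ) ≡ p [ZMOD m]) := fun h =>
        hbq (range_modEq_injective hb hq (h.trans hqp.symm))
      simp [addRow, this]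
  omega

lemma AddsBox.isCyl {α β : ℤ → ℤ} {i : ZMod n} (h : IsCyl m n α)
    (hb : AddsBox m i α β) : IsCyl m n β := by
  obtain ⟨p, -, hp, rfl⟩ := hb
  exact h.addRow hp

lemma AddsBox.size_eq {α β : ℤ → ℤ} {i : ZMod n} (hm : 0 < m) (hb : AddsBox m i α β) :
    size m β = size m α + 1 := by
  obtain ⟨p, -, hp, rfl⟩ := hb
  exact size_addRow hm α p

lemma AddsBox.le {α β : ℤ → ℤ} {i : ZMod n} (hb : AddsBox m i α β) (j : ℤ) : α j ≤ β j := by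
  obtain ⟨p, -, hp, rfl⟩ := hb
  dsimp only
  split_ifs <;> omega

/-- Adding a box on the diagonal `i` has the effect of `s_i` on the beads. -/
lemma AddsBox.bead_eq {α β : ℤ → ℤ} {i : ZMod n} (h : IsCyl m n α) (hb : AddsBox m i α β)
    (q : ℤ) : affRefl i (bead α q) = bead β q := by
  obtain ⟨p, h1, h2, rfl⟩ := (addsBox_iff h).1 hb
  rw [affRefl, if_neg (h2 q)]
  have : ((bead α q : ZMod n) + 1 = i) ↔ q ≡ p [ZMOD m] := by
    rw [← h1, add_left_inj, h.bead_cast_eq_iff]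
  simp only [this]
  unfold bead addRow
  split_ifs <;> ring

lemma WordActs.isCyl {α β : ℤ → ℤ} {ω : List (ZMod n)} (h : IsCyl m n α)
    (hw : WordActs m ω α β) : IsCyl m n β := by
  induction ω generalizing β with
  | nil => rwa [← hw]
  | cons i ω ih =>
    obtain ⟨γ, h1, h2⟩ := hw
    exact h2.isCyl (ih h1)

lemma WordActs.size_eq {α β : ℤ → ℤ} {ω : List (ZMod n)} (hm : 0 < m)
    (hw : WordActs m ω α β) : size m β = size m α + ω.length := by
  induction ω generalizing β with
  | nil => simp [show α = β from hw]
  | cons i ω ih =>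
    obtain ⟨γ, h1, h2⟩ := hw
    rw [h2.size_eq hm, ih h1, List.length_cons]
    push_cast
    ring

lemma WordActs.le {α β : ℤ → ℤ} {ω : List (ZMod n)}
    (hw : WordActs m ω α β) (j : ℤ) : α j ≤ β j := by
  induction ω generalizing β with
  | nil => rw [show α = β from hw]
  | cons i ω ih =>
    obtain ⟨γ, h1, h2⟩ := hw
    exact (ih h1).trans (h2.le j)

lemma WordActs.bead_eq {α β : ℤ → ℤ} {ω : List (ZMod n)} (hn : 3 ≤ n)
    (h : IsCyl m n α) (hw : WordActs m ω α β) (q : ℤ) :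
    affPerm hn ((cox n).wordProd ω) (bead α q) = bead β q := by
  induction ω generalizing β with
  | nil => simp [show α = β from hw]
  | cons i ω ih =>
    obtain ⟨γ, h1, h2⟩ := hw
    rw [affPerm_cons, ih h1, h2.bead_eq (h1.isCyl h)]

lemma wordActs_append {α β : ℤ → ℤ} {ω ω' : List (ZMod n)} :
    WordActs m (ω ++ ω') α β ↔ ∃ γ, WordActs m ω' α γ ∧ WordActs m ω γ β := by
  induction ω generalizing β with
  | nil => exact ⟨fun h => ⟨β, h, rfl⟩, fun ⟨γ, h, h'⟩ => h' ▸ h⟩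
  | cons i ω ih =>
    constructor
    · rintro ⟨γ, h1, h2⟩
      obtain ⟨δ, h3, h4⟩ := ih.1 h1
      exact ⟨δ, h3, γ, h4, h2⟩
    · rintro ⟨γ, h1, δ, h2, h3⟩
      exact ⟨δ, ih.2 ⟨γ, h1, h2⟩, h3⟩

lemma sum_bead_sub (α β : ℤ → ℤ) :
    ∑ p ∈ Finset.range m, (bead β p - bead α p) = size m β - size m α := by
  unfold size bead
  rw [← Finset.sum_sub_distrib]
  exact Finset.sum_congr rfl fun p _ => by ring

lemma bead_injective {α β : ℤ → ℤ} (h : ∀ q, bead α q = bead β q) : α = β := by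
  funext q
  have := h q
  unfold bead at this
  omega

/-- A word which acts without giving zero is reduced. -/
lemma WordActs.isReduced {α β : ℤ → ℤ} {ω : List (ZMod n)} (hm : 0 < m) (hn : 3 ≤ n)
    (h : IsCyl m n α) (hw : WordActs m ω α β) : (cox n).IsReduced ω := by
  refine isReduced_of_sum_affPerm hn h.bead_injOn ?_
  simp only [hw.bead_eq hn h]
  rw [sum_bead_sub, hw.size_eq hm]
  ring

/-- A word which moves the beads of `α` by as much as its number of letters acts on `α`
without giving zero. -/
lemma exists_wordActs_of_sum {α : ℤ → ℤ} {ω : List (ZMod n)} (hm : 0 < m) (hn : 3 ≤ n)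
    (h : IsCyl m n α)
    (hs : ∑ p ∈ Finset.range m, (affPerm hn ((cox n).wordProd ω) (bead α p) - bead α p) =
      ω.length) : ∃ β, WordActs m ω α β := by
  induction ω with
  | nil => exact ⟨α, rfl⟩
  | cons i ω ih =>
    rw [sum_affPerm_cons, List.length_cons] at hs
    have h1 := sum_affPerm_le hn h.bead_injOn ω
    have h2 := sum_affRefl_sub_le i (affPerm_injOn hn h.bead_injOn ω)
    push_cast at hs
    obtain ⟨γ, hγ⟩ := ih (by omega)
    have hc := hγ.isCyl h
    have h3 := exists_of_sum_affRefl_sub (i := i) (affPerm_injOn hn h.bead_injOn ω) (by omega)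
    simp only [hγ.bead_eq hn h] at h3
    obtain ⟨⟨p, -, hp⟩, hi⟩ := h3
    refine ⟨addRow m γ p, γ, hγ, (addsBox_iff hc).2 ⟨p, hp, fun q hq => ?_, rfl⟩⟩
    obtain ⟨r, hr, hrq⟩ := exists_range_modEq hm q
    exact hi r hr (by rw [hc.bead_cast_congr hrq, hq])

/-- Whether a reduced word acts without giving zero, and the result, depend only on the group
element. -/
lemma WordActs.of_isReduced {α β : ℤ → ℤ} {ω ω' : List (ZMod n)} (hm : 0 < m) (hn : 3 ≤ n)
    (h : IsCyl m n α) (hw : WordActs m ω α β) (hω' : (cox n).IsReduced ω')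
    (he : (cox n).wordProd ω' = (cox n).wordProd ω) : WordActs m ω' α β := by
  have hl : ω'.length = ω.length := by
    rw [← hω'.eq, ← (hw.isReduced hm hn h).eq, he]
  obtain ⟨β', hβ'⟩ := exists_wordActs_of_sum (ω := ω') hm hn h (by
    rw [he, hl]
    simp only [hw.bead_eq hn h]
    rw [sum_bead_sub, hw.size_eq hm]
    ring)
  have : β' = β := bead_injective fun q => by
    rw [← hβ'.bead_eq hn h, ← hw.bead_eq hn h, he]
  rwa [← this]

lemma NilActs.bead_eq {α β : ℤ → ℤ} {w : AffineSym n} (hn : 3 ≤ n)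
    (h : IsCyl m n α) (hw : NilActs m w α β) (q : ℤ) :
    affPerm hn w (bead α q) = bead β q := by
  obtain ⟨ω, ⟨-, rfl⟩, hω⟩ := hw
  exact hω.bead_eq hn h q

lemma NilActs.unique {α β β' : ℤ → ℤ} {w : AffineSym n} (hn : 3 ≤ n)
    (h : IsCyl m n α) (hw : NilActs m w α β) (hw' : NilActs m w α β') : β = β' :=
  bead_injective fun q => by rw [← hw.bead_eq hn h, ← hw'.bead_eq hn h]

lemma NilActs.size_eq {α β : ℤ → ℤ} {w : AffineSym n} (hm : 0 < m) (hw : NilActs m w α β) :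
    size m β = size m α + (cox n).length w := by
  obtain ⟨ω, ⟨hr, rfl⟩, hω⟩ := hw
  rw [hω.size_eq hm, hr.eq]

lemma NilActs.isCyl {α β : ℤ → ℤ} {w : AffineSym n} (h : IsCyl m n α)
    (hw : NilActs m w α β) : IsCyl m n β := by
  obtain ⟨ω, -, hω⟩ := hw
  exact hω.isCyl h

lemma WordActs.nilActs {α β : ℤ → ℤ} {ω : List (ZMod n)} (hm : 0 < m) (hn : 3 ≤ n)
    (h : IsCyl m n α) (hw : WordActs m ω α β) :
    NilActs m ((cox n).wordProd ω) α β :=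
  ⟨ω, ⟨hw.isReduced hm hn h, rfl⟩, hw⟩

lemma NilActs.wordActs {α β : ℤ → ℤ} {w : AffineSym n} {ω : List (ZMod n)} (hm : 0 < m)
    (hn : 3 ≤ n) (h : IsCyl m n α) (hw : NilActs m w α β)
    (hω : IsReducedWord ω w) : WordActs m ω α β := by
  obtain ⟨ω', ⟨-, rfl⟩, hω'⟩ := hw
  exact hω'.of_isReduced hm hn h hω.1 hω.2

lemma NilActs.mul {α β γ : ℤ → ℤ} {u v : AffineSym n} (hm : 0 < m) (hn : 3 ≤ n) (h : IsCyl m n α)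
    (hv : NilActs m v α γ) (hu : NilActs m u γ β) :
    NilActs m (u * v) α β := by
  obtain ⟨ω, ⟨-, rfl⟩, hω⟩ := hv
  obtain ⟨ω', ⟨-, rfl⟩, hω'⟩ := hu
  rw [← CoxeterSystem.wordProd_append]
  exact (wordActs_append.2 ⟨γ, hω, hω'⟩).nilActs hm hn h

/-- A length-additive factorization of an element which acts gives an intermediate sequence. -/
lemma NilActs.exists_of_mul {α β : ℤ → ℤ} {u v : AffineSym n} (hm : 0 < m) (hn : 3 ≤ n)
    (h : IsCyl m n α) (hw : NilActs m (u * v) α β)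
    (hl : (cox n).length (u * v) = (cox n).length u + (cox n).length v) :
    ∃ γ, NilActs m v α γ ∧ NilActs m u γ β := by
  obtain ⟨ω, h1, rfl⟩ := (cox n).exists_isReduced u
  obtain ⟨ω', h2, rfl⟩ := (cox n).exists_isReduced v
  have h3 : (cox n).IsReduced (ω ++ ω') := by
    unfold CoxeterSystem.IsReduced
    rw [CoxeterSystem.wordProd_append, hl, h1.eq, h2.eq, List.length_append]
  obtain ⟨γ, h4, h5⟩ := wordActs_append.1
    (hw.wordActs hm hn h ⟨h3, CoxeterSystem.wordProd_append _ _ _⟩)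
  exact ⟨γ, ⟨ω', ⟨h2, rfl⟩, h4⟩, ⟨ω, ⟨h1, rfl⟩, h5⟩⟩

/-! ### All words from one sequence to another represent the same element -/

/-- Below a larger cylindric sequence, a box can be added in a row where the two differ. -/
lemma exists_addRow_le {α β : ℤ → ℤ} (hm : 0 < m) (hmn : m < n) (hα : IsCyl m n α)
    (hβ : IsCyl m n β) (h : ∀ i, α i ≤ β i) (hne : α ≠ β) :
    ∃ p, α p < α (p - 1) ∧ ∀ i, addRow m α p i ≤ β i := by
  obtain ⟨q, hq⟩ := Function.ne_iff.1 hne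
  have hq' : α q < β q := lt_of_le_of_ne (h q) hq
  -- go up from row `q` to the topmost row of the same length
  have hex : ∃ k : ℕ, α q < α (q - (k : ℤ) - 1) := by
    have := hα.add_mul q (-1)
    refine ⟨m - 1, ?_⟩
    rw [show q - ((m - 1 : ℕ) : ℤ) - 1 = q + -1 * m by omega, this]
    omega
  classical
  have hk := Nat.find_spec hex
  have hkmin : ∀ j < Nat.find hex, α (q - (j : ℤ) - 1) ≤ α q := fun j hj =>
    not_lt.1 (Nat.find_min hex hj)
  set k := Nat.find hex
  have he : α (q - k) = α q := by
    refine le_antisymm ?_ (hα.anti (by omega))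
    rcases Nat.eq_zero_or_pos k with h0 | h0
    · rw [h0]; simp
    · have := hkmin (k - 1) (by omega)
      rwa [show q - ((k - 1 : ℕ) : ℤ) - 1 = q - k by omega] at this
  refine ⟨q - k, by rwa [he], fun i => ?_⟩
  unfold addRow
  split_ifs with c
  · obtain ⟨t, ht⟩ := c.dvd
    have e1 := hα.add_mul i t
    have e2 := hβ.add_mul i t
    rw [show i + t * m = q - k by linarith] at e1 e2
    have : β q ≤ β (q - k) := hβ.anti (by omega)
    omega
  · exact h i

lemma addsBox_addRow {α : ℤ → ℤ} {p : ℤ} (hp : α p < α (p - 1)) :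
    AddsBox m ((bead α p : ZMod n) + 1) α (addRow m α p) :=
  ⟨p, by unfold bead; push_cast; ring, hp, rfl⟩

/-- Words add boxes from a cylindric sequence up to any larger one. -/
lemma exists_wordActs {α β : ℤ → ℤ} (hm : 0 < m) (hmn : m < n) (hα : IsCyl m n α)
    (hβ : IsCyl m n β) (h : ∀ i, α i ≤ β i) : ∃ ω : List (ZMod n), WordActs m ω α β := by
  obtain ⟨k, hk⟩ : ∃ k : ℕ, size m β - size m α = k :=
    Int.eq_ofNat_of_zero_le (sub_nonneg.2 (Finset.sum_le_sum fun i _ => h i))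
  induction k generalizing α with
  | zero => exact ⟨[], hα.eq_of_le_of_size hm hβ h (by push_cast at hk; omega)⟩
  | succ k ih =>
    obtain ⟨p, h1, h2⟩ := exists_addRow_le hm hmn hα hβ h (by rintro rfl; push_cast at hk; omega)
    obtain ⟨ω, hω⟩ := ih (hα.addRow h1) h2 (by rw [size_addRow hm]; push_cast at hk; omega)
    exact ⟨ω ++ [_], wordActs_append.2 ⟨_, ⟨α, rfl, addsBox_addRow h1⟩, hω⟩⟩

/-- Boxes on two different diagonals `i`, `j` which can both be added to `α` can be added in either
order, with the same result. The diagonals are not adjacent, since residue `i` holds no bead but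
residue `j - 1` does, so that `s_i` and `s_j` commute. -/
lemma AddsBox.diamond {α γ δ : ℤ → ℤ} {i j : ZMod n} (hα : IsCyl m n α)
    (hi : AddsBox m i α γ) (hj : AddsBox m j α δ) (hij : i ≠ j) :
    i ≠ j + 1 ∧ j ≠ i + 1 ∧ ∃ ε, AddsBox m j γ ε ∧ AddsBox m i δ ε ∧
      ∀ q, ε q = max (γ q) (δ q) := by
  obtain ⟨p, p1, p2, rfl⟩ := (addsBox_iff hα).1 hi
  obtain ⟨q, q1, q2, rfl⟩ := (addsBox_iff hα).1 hj
  have p3 := (hα.lt_pred_iff p1).2 p2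
  have q3 := (hα.lt_pred_iff q1).2 q2
  have hpq : ¬ p ≡ q [ZMOD m] := fun h => hij (by rw [← p1, ← q1, hα.bead_cast_congr h])
  have hqp : ¬ q ≡ p [ZMOD m] := fun h => hpq h.symm
  have hij1 : i ≠ j + 1 := by
    rintro rfl
    exact q2 p (by simpa using p1)
  have hji1 : j ≠ i + 1 := by
    rintro rfl
    exact p2 q (by simpa using q1)
  have mono : ∀ r s, α r ≤ addRow m α s r := by
    intro r s; unfold addRow; split_ifs <;> omega
  refine ⟨hij1, hji1, addRow m (addRow m α p) q, ⟨q, ?_, ?_, rfl⟩, ⟨p, ?_, ?_, ?_⟩, ?_⟩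
  · rw [← q1]; simp only [addRow, if_neg hqp, bead]; push_cast; ring
  · refine lt_of_lt_of_le ?_ (mono _ _)
    simpa only [addRow, if_neg hqp] using q3
  · rw [← p1]; simp only [addRow, if_neg hpq, bead]; push_cast; ring
  · refine lt_of_lt_of_le ?_ (mono _ _)
    simpa only [addRow, if_neg hpq] using p3
  · funext r
    unfold addRow
    by_cases h1 : r ≡ p [ZMOD m] <;> by_cases h2 : r ≡ q [ZMOD m] <;> simp [h1, h2]
  · intro r
    unfold addRow
    by_cases h1 : r ≡ p [ZMOD m] <;> by_cases h2 : r ≡ q [ZMOD m] <;> simp [h1, h2]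
    exact hpq (h1.symm.trans h2)

lemma simple_mul_comm {i j : ZMod n} (hij : i ≠ j) (h1 : i ≠ j + 1) (h2 : j ≠ i + 1) :
    (cox n).simple i * (cox n).simple j = (cox n).simple j * (cox n).simple i := by
  have h := (cox n).simple_mul_simple_pow i j
  change _ ^ (if i = j then 1 else if i = j + 1 ∨ j = i + 1 then 3 else 2) = _ at h
  rw [if_neg hij, if_neg (by tauto)] at h
  have h3 := eq_inv_of_mul_eq_one_left ((pow_two _).symm.trans h)
  rw [h3, mul_inv_rev, CoxeterSystem.inv_simple, CoxeterSystem.inv_simple]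

lemma AddsBox.unique {α β β' : ℤ → ℤ} {i : ZMod n} (h : IsCyl m n α) (hb : AddsBox m i α β)
    (hb' : AddsBox m i α β') : β = β' :=
  bead_injective fun q => by rw [← hb.bead_eq h, ← hb'.bead_eq h]

/-- Two words which add boxes from `α` up to `β` represent the same group element. -/
lemma WordActs.wordProd_eq {α β : ℤ → ℤ} {ω ω' : List (ZMod n)} (hm : 0 < m) (hmn : m < n)
    (hα : IsCyl m n α) (h : WordActs m ω α β) (h' : WordActs m ω' α β) :
    (cox n).wordProd ω = (cox n).wordProd ω' := by
  induction hk : ω.length generalizing α ω ω' with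
  | zero =>
    have hs := h.size_eq hm
    rw [h'.size_eq hm, hk] at hs
    have h0 : ω'.length = 0 := by push_cast at hs; omega
    rw [List.length_eq_zero_iff.1 hk, List.length_eq_zero_iff.1 h0]
  | succ k ih =>
    have hs := h.size_eq hm
    rw [h'.size_eq hm, hk] at hs
    have hk' : ω'.length = k + 1 := by push_cast at hs; omega
    rcases List.eq_nil_or_concat' ω with rfl | ⟨ω, i, rfl⟩
    · simp at hk
    rcases List.eq_nil_or_concat' ω' with rfl | ⟨ω', j, rfl⟩
    · simp at hk'
    rw [List.length_append, List.length_singleton] at hk hk'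
    obtain ⟨γ, ⟨_, rfl, hi⟩, h1⟩ := wordActs_append.1 h
    obtain ⟨δ, ⟨_, rfl, hj⟩, h2⟩ := wordActs_append.1 h'
    have hγ := hi.isCyl hα
    have hδ := hj.isCyl hα
    simp only [CoxeterSystem.wordProd_append, CoxeterSystem.wordProd_singleton]
    by_cases hij : i = j
    · subst hij
      obtain rfl := hi.unique hα hj
      rw [ih hγ h1 h2 (by omega)]
    · obtain ⟨n1, n2, ε, he1, he2, hmax⟩ := hi.diamond hα hj hij
      obtain ⟨τ, hτ⟩ := exists_wordActs hm hmn (he1.isCyl hγ) (h1.isCyl hγ)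
        fun q => by rw [hmax]; exact max_le (h1.le q) (h2.le q)
      rw [ih (ω' := τ ++ [j]) hγ h1 (wordActs_append.2 ⟨ε, ⟨γ, rfl, he1⟩, hτ⟩) (by omega),
        ih (ω' := τ ++ [i]) hδ h2 (wordActs_append.2 ⟨ε, ⟨δ, rfl, he2⟩, hτ⟩) (by omega)]
      simp only [CoxeterSystem.wordProd_append, CoxeterSystem.wordProd_singleton]
      rw [mul_assoc, mul_assoc, simple_mul_comm hij n1 n2]

lemma NilActs.eq {α β : ℤ → ℤ} {u v : AffineSym n} (hm : 0 < m) (hmn : m < n)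
    (hα : IsCyl m n α) (hu : NilActs m u α β) (hv : NilActs m v α β) : u = v := by
  obtain ⟨ω, ⟨-, rfl⟩, hω⟩ := hu
  obtain ⟨ω', ⟨-, rfl⟩, hω'⟩ := hv
  exact hω.wordProd_eq hm hmn hα hω'

lemma exists_nilActs {α β : ℤ → ℤ} (hm : 0 < m) (hmn : m < n) (hn : 3 ≤ n) (hα : IsCyl m n α)
    (hβ : IsCyl m n β) (h : ∀ i, α i ≤ β i) : ∃ w : AffineSym n, NilActs m w α β := by
  obtain ⟨ω, hω⟩ := exists_wordActs hm hmn hα hβ h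
  exact ⟨_, hω.nilActs hm hn hα⟩

/-! ### Horizontal strips and cyclically decreasing words -/

/-- `β / α` is a horizontal strip: it has at most one box in each column. -/
def Strip (α β : ℤ → ℤ) : Prop := ∀ p, α p ≤ β p ∧ β p ≤ α (p - 1)

lemma isCycDecWord_cons {i : ZMod n} {ω : List (ZMod n)} (hn : 3 ≤ n) :
    IsCycDecWord (i :: ω) ↔ IsCycDecWord ω ∧ i ∉ ω ∧ i + 1 ∉ ω := by
  have h1 : i + 1 ≠ i := fun h => zmod_one_ne_zero hn (by simpa using h)
  have step : ∀ a : ZMod n, a ≠ i → (i :: ω).idxOf a = ω.idxOf a + 1 := fun a ha =>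
    List.idxOf_cons_ne _ ha.symm
  constructor
  · rintro ⟨hnd, h⟩
    rw [List.nodup_cons] at hnd
    refine ⟨⟨hnd.2, fun j hj hj1 => ?_⟩, hnd.1, fun hi => ?_⟩
    · have h2 := h j (List.mem_cons_of_mem _ hj) (List.mem_cons_of_mem _ hj1)
      rw [step _ (fun e => hnd.1 (e ▸ hj)), step _ (fun e => hnd.1 (e ▸ hj1))] at h2
      omega
    · have h2 := h i List.mem_cons_self (List.mem_cons_of_mem _ hi)
      rw [List.idxOf_cons_self] at h2
      omega
  · rintro ⟨⟨hnd, h⟩, hi, hi1⟩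
    refine ⟨List.nodup_cons.2 ⟨hi, hnd⟩, fun j hj hj1 => ?_⟩
    rcases List.mem_cons.1 hj with rfl | hj
    · rcases List.mem_cons.1 hj1 with e | hj1
      · exact absurd e h1
      · exact absurd hj1 hi1
    · rcases List.mem_cons.1 hj1 with e | hj1
      · rw [e, List.idxOf_cons_self, step j (fun e => hi (e ▸ hj))]
        omega
      · rw [step j (fun e => hi (e ▸ hj)), step _ (fun e => hi (e ▸ hj1))]
        have := h j hj hj1
        omega

/-- The letters of a word which acts are the diagonals of the added boxes. -/
lemma WordActs.mem_iff {α β : ℤ → ℤ} {ω : List (ZMod n)} (hα : IsCyl m n α)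
    (hw : WordActs m ω α β) (i : ZMod n) :
    i ∈ ω ↔ ∃ p j : ℤ, α p < j ∧ j ≤ β p ∧ ((j - p : ℤ) : ZMod n) = i := by
  induction ω generalizing β with
  | nil =>
    rw [show α = β from hw]
    simp only [List.not_mem_nil, false_iff]
    rintro ⟨p, j, h1, h2, -⟩
    omega
  | cons a ω ih =>
    obtain ⟨γ, h1, h2⟩ := hw
    have hγ := h1.isCyl hα
    obtain ⟨q, hq, -, rfl⟩ := (addsBox_iff hγ).1 h2
    rw [List.mem_cons, ih h1]
    constructor
    · rintro (rfl | ⟨p, j, h3, h4, h5⟩)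
      · refine ⟨q, γ q + 1, by have := h1.le q; omega, by simp [addRow], ?_⟩
        rw [← hq]; unfold bead; push_cast; ring
      · exact ⟨p, j, h3, h4.trans (h2.le p), h5⟩
    · rintro ⟨p, j, h3, h4, h5⟩
      by_cases hj : j ≤ γ p
      · exact Or.inr ⟨p, j, h3, hj, h5⟩
      · left
        by_cases hp : p ≡ q [ZMOD m]
        · rw [addRow, if_pos hp] at h4
          rw [← hq, ← h5, ← hγ.bead_cast_congr hp, show j = γ p + 1 by omega]
          unfold bead; push_cast; ring
        · rw [addRow, if_neg hp] at h4
          exact absurd h4 hj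

/-- Cyclically decreasing words add horizontal strips. -/
lemma WordActs.strip {α β : ℤ → ℤ} {ω : List (ZMod n)} (hn : 3 ≤ n) (hα : IsCyl m n α)
    (hw : WordActs m ω α β) (hω : IsCycDecWord ω) : Strip α β := by
  induction ω generalizing β with
  | nil =>
    rw [← show α = β from hw]
    exact fun p => ⟨le_rfl, hα.anti (by omega)⟩
  | cons i ω ih =>
    obtain ⟨γ, h1, h2⟩ := hw
    obtain ⟨h3, -, h4⟩ := (isCycDecWord_cons hn).1 hω
    have hγ := h1.isCyl hα
    have hs := ih h1 h3
    obtain ⟨q, hq, hqi, rfl⟩ := (addsBox_iff hγ).1 h2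
    refine fun p => ⟨(hs p).1.trans (h2.le p), ?_⟩
    unfold addRow
    split_ifs with hp
    · by_contra hlt
      have hpi : (bead γ p : ZMod n) + 1 = i := by rw [hγ.bead_cast_congr hp, hq]
      have h5 := (hγ.lt_pred_iff hpi).2 hqi
      have h6 := hs p
      -- the box above the new one lies in the strip already, on the diagonal `i + 1`
      refine h4 ((h1.mem_iff hα _).2 ⟨p - 1, γ p + 1, by omega, by omega, ?_⟩)
      rw [← hpi]
      unfold bead
      push_cast
      ring
    · exact (hs p).2

lemma Strip.bead_le {α β : ℤ → ℤ} (h : Strip α β) (p : ℤ) : bead β p < bead α (p - 1) := by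
  have := (h p).2
  unfold bead
  omega

/-- The diagonal of a box of a horizontal strip carries no bead of the inner sequence. -/
lemma Strip.bead_ne {α β : ℤ → ℤ} (hα : IsCyl m n α) (h : Strip α β) {p j : ℤ}
    (h1 : α p < j) (h2 : j ≤ β p) (q : ℤ) : (bead α q : ZMod n) ≠ ((j - p : ℤ) : ZMod n) := by
  intro he
  obtain ⟨r, -, hr⟩ := hα.exists_bead_eq he
  have h3 := h.bead_le p
  have h4 : r < p := hα.bead_strictAnti.lt_iff_gt.1 (by rw [hr]; unfold bead; omega)
  have h5 : p - 1 < r := hα.bead_strictAnti.lt_iff_gt.1 (by rw [hr]; unfold bead at *; omega)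
  omega

/-- Every horizontal strip is added by a cyclically decreasing word. -/
lemma Strip.exists_wordActs {α β : ℤ → ℤ} (hm : 0 < m) (hn : 3 ≤ n) (hα : IsCyl m n α)
    (hβ : IsCyl m n β) (h : Strip α β) :
    ∃ ω : List (ZMod n), IsCycDecWord ω ∧ WordActs m ω α β := by
  obtain ⟨k, hk⟩ : ∃ k : ℕ, size m β - size m α = k :=
    Int.eq_ofNat_of_zero_le (sub_nonneg.2 (Finset.sum_le_sum fun i _ => (h i).1))
  induction k generalizing β with
  | zero =>
    exact ⟨[], ⟨List.nodup_nil, by simp⟩,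
      hα.eq_of_le_of_size hm hβ (fun i => (h i).1) (by push_cast at hk; omega)⟩
  | succ k ih =>
    obtain ⟨q, hq⟩ : ∃ q, α q ≠ β q :=
      Function.ne_iff.1 (by rintro rfl; push_cast at hk; omega)
    -- remove the last box of row `q`
    have hcong : ∀ p, p ≡ q [ZMOD m] → α p < β p := by
      intro p hp
      obtain ⟨t, ht⟩ := hp.dvd
      have e1 := hα.add_mul p t
      have e2 := hβ.add_mul p t
      rw [show p + t * m = q by linarith] at e1 e2
      have := (h q).1
      omega
    set γ : ℤ → ℤ := fun p => if p ≡ q [ZMOD m] then β p - 1 else β p with hγdef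
    have hγβ : addRow m γ q = β := by
      funext p
      simp only [addRow, hγdef]
      split_ifs <;> ring
    have hγle : ∀ p, γ p ≤ β p := by
      intro p; simp only [hγdef]; split_ifs <;> omega
    have hαγ : ∀ p, α p ≤ γ p := by
      intro p
      have := (h p).1
      simp only [hγdef]
      split_ifs with hp
      · have := hcong p hp; omega
      · exact this
    have hγ : IsCyl m n γ := by
      constructor
      · refine antitone_int_of_succ_le fun p => ?_
        have e1 := (h (p + 1)).2
        rw [add_sub_cancel_right] at e1
        exact (hγle _).trans (e1.trans (hαγ p))
      · intro p
        have : (p + m ≡ q [ZMOD m]) ↔ (p ≡ q [ZMOD m]) := by simp [Int.ModEq]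
        simp only [hγdef, this, hβ.period]
        split_ifs <;> ring
    have hs : Strip α γ := fun p => ⟨hαγ p, (hγle p).trans (h p).2⟩
    obtain ⟨ω, hω, hact⟩ := ih hγ hs (by
      have := size_addRow hm γ q
      rw [hγβ] at this
      push_cast at hk
      omega)
    have hbox : AddsBox m ((bead γ q : ZMod n) + 1) γ β := by
      have h1 : γ q < γ (q - 1) := by
        have e1 := (h q).2
        have e2 := hαγ (q - 1)
        have e3 : γ q = β q - 1 := if_pos rfl
        omega
      have := addsBox_addRow (m := m) (n := n) h1
      rwa [hγβ] at this
    have hγq : γ q = β q - 1 := if_pos rfl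
    have hbq : (bead γ q : ZMod n) + 1 = (bead β q : ZMod n) := by
      unfold bead; rw [hγq]; push_cast; ring
    rw [hbq] at hbox
    refine ⟨(bead β q : ZMod n) :: ω, (isCycDecWord_cons hn).2 ⟨hω, ?_, ?_⟩, γ, hact, hbox⟩
    · rw [hact.mem_iff hα]
      rintro ⟨p, j, h1, h2, h3⟩
      obtain ⟨r, hr, hrj⟩ := hβ.exists_bead_eq h3.symm
      have e1 := (h r).1
      have e2 := hs.bead_le p
      rcases lt_trichotomy r p with hrp | rfl | hrp
      · have := hα.bead_strictAnti.antitone (show r ≤ p - 1 by omega)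
        unfold bead at *
        omega
      · have : γ r = β r - 1 := if_pos hr
        unfold bead at *
        omega
      · have e3 := h.bead_le r
        have := hα.bead_strictAnti.antitone (show p ≤ r - 1 by omega)
        unfold bead at *
        omega
    · rw [hact.mem_iff hα]
      rintro ⟨p, j, h1, h2, h3⟩
      obtain ⟨r, hr, hrj⟩ := hβ.exists_bead_eq (p := q) (x := j - p - 1) (by
        rw [Int.cast_sub, h3]; simp)
      have e1 := hcong r hr
      have e2 := hs.bead_le p
      rcases le_or_gt p r with hrp | hrp
      · rcases hrp.eq_or_lt with rfl | hrp
        · have : γ p = β p - 1 := if_pos hr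
          unfold bead at *
          omega
        · have e3 := h.bead_le r
          have := hα.bead_strictAnti.antitone (show p ≤ r - 1 by omega)
          unfold bead at *
          omega
      · have := hα.bead_strictAnti.antitone (show r ≤ p - 1 by omega)
        unfold bead at *
        omega

/-- The residues modulo `n` of the beads of `α`. -/
def beadResidues (m n : ℕ) (α : ℤ → ℤ) : Finset (ZMod n) :=
  (Finset.range m).image fun p : ℕ => (bead α p : ZMod n)

lemma IsCyl.mem_beadResidues {α : ℤ → ℤ} (hm : 0 < m) (hα : IsCyl m n α) {i : ZMod n} :
    i ∈ beadResidues m n α ↔ ∃ p, (bead α p : ZMod n) = i := by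
  simp only [beadResidues, Finset.mem_image]
  constructor
  · rintro ⟨p, -, h⟩; exact ⟨p, h⟩
  · rintro ⟨p, h⟩
    obtain ⟨q, hq, hqp⟩ := exists_range_modEq hm p
    exact ⟨q, hq, by rw [hα.bead_cast_congr hqp, h]⟩

lemma IsCyl.card_beadResidues {α : ℤ → ℤ} (hα : IsCyl m n α) :
    (beadResidues m n α).card = m := by
  rw [beadResidues, Finset.card_image_of_injOn hα.bead_injOn, Finset.card_range]

/-- A cyclically decreasing word which acts has only letters without a bead on them. -/
lemma WordActs.notMem_beadResidues {α β : ℤ → ℤ} {ω : List (ZMod n)} (hm : 0 < m) (hn : 3 ≤ n)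
    (hα : IsCyl m n α) (hw : WordActs m ω α β) (hω : IsCycDecWord ω) {i : ZMod n} (hi : i ∈ ω) :
    i ∉ beadResidues m n α := by
  obtain ⟨p, j, h1, h2, rfl⟩ := (hw.mem_iff hα i).1 hi
  rw [hα.mem_beadResidues hm]
  rintro ⟨q, hq⟩
  exact (hw.strip hn hα hω).bead_ne hα h1 h2 q hq

lemma Strip.exists_isD {α β : ℤ → ℤ} (hm : 0 < m) (hn : 3 ≤ n) (hα : IsCyl m n α)
    (hβ : IsCyl m n β) (h : Strip α β) :
    ∃ w : AffineSym n, IsCycDec w ∧ NilActs m w α β := by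
  obtain ⟨ω, h1, h2⟩ := h.exists_wordActs hm hn hα hβ
  refine ⟨_, ⟨ω.toFinset, ⟨(bead α 0 : ZMod n), fun hmem => ?_⟩, ω, h1, rfl, rfl⟩,
    h2.nilActs hm hn hα⟩
  exact h2.notMem_beadResidues hm hn hα h1 (List.mem_toFinset.1 hmem)
    ((hα.mem_beadResidues hm).2 ⟨0, rfl⟩)

/-- Put a bead on each residue which is not a letter of a cyclically decreasing word. Then every
letter of the word moves a bead forward, so the word is reduced. -/
lemma IsCycDecWord.isReduced {ω : List (ZMod n)} (hn : 3 ≤ n) (hω : IsCycDecWord ω) :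
    (cox n).IsReduced ω := by
  have : NeZero n := ⟨by omega⟩
  set s : Finset (ZMod n) := Finset.univ.filter (· ∉ ω) with hs
  set e : ZMod n → ℤ := fun x => (x.val : ℤ) with he
  have hcast : ∀ x, (e x : ZMod n) = x := fun x => by simp [he]
  have hinj : (s : Set (ZMod n)).InjOn fun x => (e x : ZMod n) := by
    intro x _ y _ hxy
    simpa only [hcast] using hxy
  have h10 := zmod_one_ne_zero hn
  -- `x` holds a bead after the letters of the suffix `τ` have acted iff `x` is either no letter
  -- of the word or in `τ`, and `x + 1` is not in `τ`
  have key : ∀ τ σ : List (ZMod n), σ ++ τ = ω → IsCycDecWord τ →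
      (∑ x ∈ s, (affPerm hn ((cox n).wordProd τ) (e x) - e x) = τ.length) ∧
      ∀ y : ZMod n, (∃ x ∈ s, (affPerm hn ((cox n).wordProd τ) (e x) : ZMod n) = y) ↔
        (y ∉ ω ∨ y ∈ τ) ∧ y + 1 ∉ τ := by
    intro τ
    induction τ with
    | nil =>
      intro σ _ _
      refine ⟨by simp, fun y => ?_⟩
      simp only [affPerm_nil, hcast]
      simp [hs]
    | cons i τ ih =>
      intro σ hσ hdec
      obtain ⟨hdec', hi, hi1⟩ := (isCycDecWord_cons hn).1 hdec
      obtain ⟨ih1, ih2⟩ := ih (σ ++ [i]) (by simpa using hσ) hdec'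
      have hiω : i ∈ ω := by rw [← hσ]; simp
      have hinj' := affPerm_injOn hn hinj τ
      -- `i - 1` is not to the left of `i`
      have hpred : i - 1 ∉ ω ∨ i - 1 ∈ τ := by
        by_contra! hc
        obtain ⟨hc1, hc2⟩ := hc
        have h1 := hω.2 (i - 1) hc1 (by simpa using hiω)
        rw [sub_add_cancel] at h1
        have hne : i - 1 ≠ i := fun h => h10 (by simpa using h)
        have hσmem : i - 1 ∈ σ := by
          rw [← hσ] at hc1
          simpa [hne, hc2] using hc1
        have hiσ : i ∉ σ := by
          intro h
          have := hω.1
          rw [← hσ] at this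
          exact List.disjoint_of_nodup_append this h List.mem_cons_self
        rw [← hσ, List.idxOf_append_of_mem hσmem, List.idxOf_append_of_notMem hiσ] at h1
        have := List.idxOf_lt_length_iff.2 hσmem
        omega
      have h1 : ∃ x ∈ s, (affPerm hn ((cox n).wordProd τ) (e x) : ZMod n) + 1 = i := by
        obtain ⟨x, hx, hx'⟩ := (ih2 (i - 1)).2 ⟨hpred, by simpa using hi⟩
        exact ⟨x, hx, by rw [hx']; ring⟩
      have h2 : ∀ x ∈ s, (affPerm hn ((cox n).wordProd τ) (e x) : ZMod n) ≠ i := by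
        intro x hx hxi
        have := (ih2 i).1 ⟨x, hx, hxi⟩
        tauto
      refine ⟨?_, fun y => ?_⟩
      · rw [sum_affPerm_cons, ih1, sum_affRefl_sub_eq_one hinj' h1 h2, List.length_cons]
        push_cast
        ring
      · have hy : (∃ x ∈ s, (affPerm hn ((cox n).wordProd (i :: τ)) (e x) : ZMod n) = y) ↔
            ∃ x ∈ s, (affPerm hn ((cox n).wordProd τ) (e x) : ZMod n) =
              Equiv.swap (i - 1) i y := by
          simp only [affPerm_cons, affRefl_cast hn]
          refine exists_congr fun x => and_congr_right fun _ => ?_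
          rw [← Equiv.symm_apply_eq, Equiv.symm_swap, eq_comm]
        rw [hy, ih2]
        simp only [List.mem_cons, not_or]
        by_cases e1 : y = i
        · subst e1
          have : y + 1 ≠ y := fun h => h10 (by simpa using h)
          simp only [Equiv.swap_apply_right, sub_add_cancel]
          tauto
        by_cases e2 : y = i - 1
        · subst e2
          simp only [Equiv.swap_apply_left, sub_add_cancel]
          tauto
        · rw [Equiv.swap_apply_of_ne_of_ne e2 e1]
          have : y + 1 ≠ i := fun h => e2 (by rw [← h]; ring)
          tauto
  exact isReduced_of_sum_affPerm hn hinj (key ω [] rfl hω).1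

lemma IsCycIncWord.reverse {ω : List (ZMod n)} (hω : IsCycIncWord ω) :
    IsCycDecWord ω.reverse := by
  have key : ∀ a ∈ ω, ω.reverse.idxOf a + ω.idxOf a + 1 = ω.length := by
    have : ∀ τ : List (ZMod n), τ.Nodup → ∀ a ∈ τ,
        τ.reverse.idxOf a + τ.idxOf a + 1 = τ.length := by
      intro τ
      induction τ with
      | nil => simp
      | cons b τ ih =>
        intro hnd a ha
        rw [List.nodup_cons] at hnd
        rw [List.reverse_cons, List.length_cons]
        rcases List.mem_cons.1 ha with rfl | ha
        · rw [List.idxOf_append_of_notMem (by simpa using hnd.1)]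
          simp
        · have : b ≠ a := fun e => hnd.1 (e ▸ ha)
          rw [List.idxOf_append_of_mem (by simpa using ha), List.idxOf_cons_ne _ this]
          have := ih hnd.2 a ha
          omega
    exact this ω hω.1
  refine ⟨List.nodup_reverse.2 hω.1, fun i hi hi1 => ?_⟩
  rw [List.mem_reverse] at hi hi1
  have h1 := key i hi
  have h2 := key _ hi1
  have h3 := hω.2 i hi hi1
  omega

lemma IsCycIncWord.isReduced {ω : List (ZMod n)} (hn : 3 ≤ n) (hω : IsCycIncWord ω) :
    (cox n).IsReduced ω :=
  ((cox n).isReduced_reverse_iff ω).1 (hω.reverse.isReduced hn)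

/-! ### Elements which act lie in `A_{(n-m,m)}` -/

lemma isCycIncWord_of_cons {i : ZMod n} {ω : List (ZMod n)}
    (h : IsCycIncWord (i :: ω)) : IsCycIncWord ω ∧ i - 1 ∉ ω := by
  obtain ⟨hnd, h⟩ := h
  rw [List.nodup_cons] at hnd
  have step : ∀ a ∈ ω, (i :: ω).idxOf a = ω.idxOf a + 1 := fun a ha =>
    List.idxOf_cons_ne _ (by rintro rfl; exact hnd.1 ha)
  refine ⟨⟨hnd.2, fun j hj hj1 => ?_⟩, fun hi => ?_⟩
  · have h2 := h j (List.mem_cons_of_mem _ hj) (List.mem_cons_of_mem _ hj1)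
    rw [step _ hj, step _ hj1] at h2
    omega
  · have h2 := h (i - 1) (List.mem_cons_of_mem _ hi) (by simp)
    rw [sub_add_cancel, List.idxOf_cons_self] at h2
    omega

/-- A cyclically increasing word moves each bead at most one step, so that its letters `i` belong to
different beads, on the residues `i - 1`. -/
lemma WordActs.sub_one_mem_beadResidues {α β : ℤ → ℤ} {ω : List (ZMod n)} (hm : 0 < m)
    (hα : IsCyl m n α) (hw : WordActs m ω α β) (hω : IsCycIncWord ω) {i : ZMod n}
    (hi : i ∈ ω) : i - 1 ∈ beadResidues m n α := by
  induction ω generalizing β with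
  | nil => simp at hi
  | cons a ω ih =>
    obtain ⟨γ, h1, h2⟩ := hw
    obtain ⟨h3, h4⟩ := isCycIncWord_of_cons hω
    rcases List.mem_cons.1 hi with rfl | hi
    · obtain ⟨q, hq, -⟩ := (addsBox_iff (h1.isCyl hα)).1 h2
      rw [hα.mem_beadResidues hm]
      have hq' : (bead γ q : ZMod n) = i - 1 := by rw [← hq]; ring
      rcases (h1.le q).eq_or_lt with he | hlt
      · exact ⟨q, by rw [← hq']; unfold bead; rw [he]⟩
      · exact absurd ((h1.mem_iff hα _).2 ⟨q, γ q, hlt, le_rfl, hq'⟩) h4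
    · exact ih h1 h3 hi

lemma NilActs.maxr_le {α β : ℤ → ℤ} {w : AffineSym n} (hm : 0 < m) (hn : 3 ≤ n)
    (hα : IsCyl m n α) (hw : NilActs m w α β) : maxr w ≤ n - m := by
  have : NeZero n := ⟨by omega⟩
  refine csSup_le' ?_
  rintro _ ⟨J, v, u, rfl, ⟨-, ω, hω, rfl, rfl⟩, rfl, hl⟩
  obtain ⟨γ, h1, -⟩ := hw.exists_of_mul hm hn hα hl
  have h2 := h1.wordActs hm hn hα ⟨hω.isReduced hn, rfl⟩
  have hsub : ω.toFinset ⊆ (beadResidues m n α)ᶜ := fun i hi =>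
    Finset.mem_compl.2 (h2.notMem_beadResidues hm hn hα hω (List.mem_toFinset.1 hi))
  refine (Finset.card_le_card hsub).trans ?_
  rw [Finset.card_compl, hα.card_beadResidues, ZMod.card]

lemma NilActs.maxc_le {α β : ℤ → ℤ} {w : AffineSym n} (hm : 0 < m) (hn : 3 ≤ n)
    (hα : IsCyl m n α) (hw : NilActs m w α β) : maxc w ≤ m := by
  refine csSup_le' ?_
  rintro _ ⟨J, v, u, rfl, ⟨-, ω, hω, rfl, rfl⟩, rfl, hl⟩
  obtain ⟨γ, h1, -⟩ := hw.exists_of_mul hm hn hα hl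
  have h2 := h1.wordActs hm hn hα ⟨hω.isReduced hn, rfl⟩
  refine (Finset.card_le_card_of_injOn (t := beadResidues m n α) (fun i => i - 1) (fun i hi => ?_)
    sub_left_injective.injOn).trans hα.card_beadResidues.le
  exact h2.sub_one_mem_beadResidues hm hα hω (List.mem_toFinset.1 hi)

lemma AddsBox.bead_cast {α β : ℤ → ℤ} {i : ZMod n} (hn : 3 ≤ n) (h : IsCyl m n α)
    (hb : AddsBox m i α β) (q : ℤ) :
    (bead β q : ZMod n) = Equiv.swap (i - 1) i (bead α q : ZMod n) := by
  rw [← hb.bead_eq h, affRefl_cast hn]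

/-- After `s_i` has moved a bead from residue `i - 1` to `i` and `s_{i+1}` has moved it on, no bead
is left on residue `i - 1` for the second `s_i`. -/
lemma NilActs.is321Avoiding {α β : ℤ → ℤ} {w : AffineSym n} (hm : 0 < m) (hn : 3 ≤ n)
    (hα : IsCyl m n α) (hw : NilActs m w α β) : Is321Avoiding w := by
  rintro ω hω i ⟨σ, τ, rfl⟩
  have h := hw.wordActs hm hn hα hω
  rw [List.append_assoc, wordActs_append] at h
  obtain ⟨δ, h, -⟩ := h
  obtain ⟨γ, h1, γ₃, ⟨γ₂, ⟨γ₁, h2, h3⟩, h4⟩, h5⟩ := wordActs_append.1 h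
  obtain rfl : γ = γ₁ := h2
  have hγ := h1.isCyl hα
  have hγ₂ := h3.isCyl hγ
  obtain ⟨-, -, hi, -⟩ := (addsBox_iff hγ).1 h3
  obtain ⟨p, hp, -⟩ := (addsBox_iff (h4.isCyl hγ₂)).1 h5
  have h10 := zmod_one_ne_zero hn
  have h20 := zmod_two_ne_zero hn
  have hp' : (bead γ₃ p : ZMod n) = i - 1 := by rw [← hp]; ring
  have he : Equiv.swap i (i + 1) (i - 1) = i - 1 :=
    Equiv.swap_apply_of_ne_of_ne (by grind) (by grind)
  rw [h4.bead_cast hn hγ₂, h3.bead_cast hn hγ, add_sub_cancel_right,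
    ← Equiv.eq_symm_apply, Equiv.symm_swap, he,
    ← Equiv.eq_symm_apply, Equiv.symm_swap, Equiv.swap_apply_left] at hp'
  exact hi p hp'

/-- Every element which acts on a cylindric sequence without giving zero lies in
`A_{(n-m,m)}`. -/
lemma NilActs.mem_setA {α β : ℤ → ℤ} {w : AffineSym n} (hm : 0 < m) (hn : 3 ≤ n)
    (hα : IsCyl m n α) (hw : NilActs m w α β) : w ∈ setA m n :=
  ⟨hw.is321Avoiding hm hn hα, hw.maxc_le hm hn hα, hw.maxr_le hm hn hα⟩

/-! ### Partitions in a box and the map `φ` -/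

lemma BoxPartition.shift_isCyl (hm : 0 < m) (lam : BoxPartition m n) (hmn : m < n) (r : ℤ) :
    IsCyl m n (lam.shift r) := by
  have h0 : (m : ℤ) ≠ 0 := by omega
  have hpos : (0 : ℤ) < m := by omega
  constructor
  · refine antitone_int_of_succ_le fun i => ?_
    unfold BoxPartition.shift
    set x := i - r - 1 with hx
    rw [show i + 1 - r - 1 = x + 1 by omega]
    have hr0 := Int.emod_nonneg x h0
    have hrm := Int.emod_lt_of_pos x hpos
    have hdm := Int.mul_ediv_add_emod x m
    by_cases hc : x % m + 1 < m
    · have hd : (x + 1) / m = x / m := by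
        rw [Int.ediv_eq_iff_of_pos hpos]; constructor <;> nlinarith
      have hmod : (x + 1) % m = x % m + 1 := by
        have := Int.mul_ediv_add_emod (x + 1) m
        rw [hd] at this; linarith
      rw [hd, hmod]
      have := lam.anti (show (x % m).toNat ≤ (x % m + 1).toNat by omega)
      omega
    · have hd : (x + 1) / m = x / m + 1 := by
        rw [Int.ediv_eq_iff_of_pos hpos]; constructor <;> nlinarith
      have hmod : (x + 1) % m = 0 := by
        have := Int.mul_ediv_add_emod (x + 1) m
        rw [hd] at this; nlinarith
      rw [hd, hmod]
      have h1 := lam.part_le (0 : ℤ).toNat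
      have h2 : ((n - m : ℕ) : ℤ) = n - m := by omega
      have h3 : (lam.part (0 : ℤ).toNat : ℤ) ≤ n - m := by rw [← h2]; exact_mod_cast h1
      have : (x / m + 1) * ((n : ℤ) - m) = x / m * ((n : ℤ) - m) + (n - m) := by ring
      omega
  · intro i
    unfold BoxPartition.shift
    rw [show i + m - r - 1 = (i - r - 1) + m by ring, Int.add_emod_right,
      Int.add_ediv_of_dvd_right (dvd_refl _), Int.ediv_self h0]
    ring

lemma BoxPartition.empty_shift_zero (i : ℤ) :
    (BoxPartition.empty m n).shift 0 i = -((i - 1) / m * ((n : ℤ) - m)) := by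
  simp [BoxPartition.shift, BoxPartition.empty]

lemma BoxPartition.empty_le_shift (hm : 0 < m) (hmn : m < n) (lam : BoxPartition m n) (d : ℕ)
    (i : ℤ) : (BoxPartition.empty m n).shift 0 i ≤ lam.shift d i := by
  rw [BoxPartition.empty_shift_zero]
  unfold BoxPartition.shift
  have h1 : (i - d - 1) / (m : ℤ) ≤ (i - 1) / m := Int.ediv_le_ediv (by omega) (by omega)
  have h2 := mul_le_mul_of_nonneg_right h1 (show (0 : ℤ) ≤ (n : ℤ) - m by omega)
  omega

/-- The only box which can be added to the empty shape lies on the diagonal `0`. -/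
lemma AddsBox.eq_zero_of_empty {i : ZMod n} {β : ℤ → ℤ} (hm : 0 < m)
    (h : AddsBox m i ((BoxPartition.empty m n).shift 0) β) : i = 0 := by
  obtain ⟨p, rfl, hp, -⟩ := h
  simp only [BoxPartition.empty_shift_zero] at hp ⊢
  have hpos : (0 : ℤ) < m := by omega
  have hne : (p - 1) / (m : ℤ) ≠ (p - 1 - 1) / m := by
    intro h
    rw [h] at hp
    exact lt_irrefl _ hp
  obtain ⟨k, hk⟩ : (m : ℤ) ∣ p - 1 := by
    by_contra hdvd
    refine hne (Eq.symm ((Int.ediv_eq_iff_of_pos hpos).2 ?_))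
    have h1 := Int.mul_ediv_add_emod (p - 1) m
    have h2 := Int.emod_nonneg (p - 1) hpos.ne'
    have h3 := Int.emod_lt_of_pos (p - 1) hpos
    have h4 : (p - 1) % (m : ℤ) ≠ 0 := fun h => hdvd (Int.dvd_of_emod_eq_zero h)
    have h5 : 1 ≤ (p - 1) % (m : ℤ) := by omega
    constructor <;> nlinarith
  rw [hk, Int.mul_ediv_cancel_left _ hpos.ne', show p = m * k + 1 by omega,
    show -(k * ((n : ℤ) - m)) + 1 - (m * k + 1) = -k * n by ring]
  simp

lemma NilActs.isZeroGrassmannian {β : ℤ → ℤ} {w : AffineSym n} (hm : 0 < m) (hmn : m < n)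
    (hn : 3 ≤ n) (hw : NilActs m w ((BoxPartition.empty m n).shift 0) β) :
    IsZeroGrassmannian w := by
  intro ω hω hne
  have h := hw.wordActs hm hn (BoxPartition.shift_isCyl hm _ hmn 0) hω
  rw [← List.dropLast_append_getLast hne, wordActs_append] at h
  obtain ⟨γ, ⟨_, rfl, h1⟩, -⟩ := h
  exact h1.eq_zero_of_empty hm

/-- Membership in `A⁰_{(n-m,m)}` is automatic for elements which act on the empty shape. -/
lemma isPhiPreimage_iff {w : AffineSym n} {lam : BoxPartition m n} {d : ℕ} (hm : 0 < m)
    (hmn : m < n) (hn : 3 ≤ n) :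
    IsPhiPreimage w lam d ↔ NilActs m w ((BoxPartition.empty m n).shift 0) (lam.shift d) :=
  ⟨fun h => h.2, fun h => ⟨⟨h.mem_setA hm hn (BoxPartition.shift_isCyl hm _ hmn 0),
    h.isZeroGrassmannian hm hmn hn⟩, h⟩⟩

lemma existsUnique_isPhiPreimage (hm : 0 < m) (hmn : m < n) (hn : 3 ≤ n)
    (lam : BoxPartition m n) (d : ℕ) : ∃! w : AffineSym n, IsPhiPreimage w lam d := by
  have hα := BoxPartition.shift_isCyl hm (BoxPartition.empty m n) hmn 0
  obtain ⟨w, hw⟩ := exists_nilActs hm hmn hn hα (lam.shift_isCyl hm hmn d)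
    (lam.empty_le_shift hm hmn d)
  refine ⟨w, (isPhiPreimage_iff hm hmn hn).2 hw, fun v hv => ?_⟩
  exact NilActs.eq hm hmn hα ((isPhiPreimage_iff hm hmn hn).1 hv) hw

/-! ### The Bender–Knuth involution -/

/-- The Bender–Knuth reflection: if `β / γ` and `γ / α` are horizontal strips, then `γ_p` ranges
over an interval which depends on `α`, `β` and `p` only, and is reflected in it. -/
def benderKnuth (α γ β : ℤ → ℤ) : ℤ → ℤ := fun p =>
  max (α p) (β (p + 1)) + min (α (p - 1)) (β p) - γ p

lemma benderKnuth_benderKnuth (α γ β : ℤ → ℤ) :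
    benderKnuth α (benderKnuth α γ β) β = γ := by
  funext p
  simp [benderKnuth]

section BenderKnuth
variable {α γ β : ℤ → ℤ}

lemma strip_benderKnuth (h1 : Strip α γ) (h2 : Strip γ β) : Strip α (benderKnuth α γ β) := by
  intro p
  have e1 := h1 p
  have e2 := h2 p
  have e3 := (h2 (p + 1)).2
  rw [add_sub_cancel_right] at e3
  unfold benderKnuth
  omega

lemma benderKnuth_strip (h1 : Strip α γ) (h2 : Strip γ β) : Strip (benderKnuth α γ β) β := by
  intro p
  have e1 := h1 p
  have e2 := h2 p
  have e3 := (h2 (p + 1)).2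
  have e4 := h1 (p - 1)
  have e5 := h2 (p - 1)
  rw [add_sub_cancel_right] at e3
  unfold benderKnuth
  rw [sub_add_cancel]
  omega

lemma isCyl_benderKnuth (hα : IsCyl m n α) (hγ : IsCyl m n γ) (hβ : IsCyl m n β)
    (h1 : Strip α γ) (h2 : Strip γ β) : IsCyl m n (benderKnuth α γ β) := by
  constructor
  · refine antitone_int_of_succ_le fun p => ?_
    have e1 := (benderKnuth_strip h1 h2 (p + 1)).1
    have e2 := (strip_benderKnuth h1 h2 (p + 1)).2
    have e3 := (strip_benderKnuth h1 h2 p).1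
    rw [add_sub_cancel_right] at e2
    exact e2.trans e3
  · intro p
    unfold benderKnuth
    rw [show p + m + 1 = (p + 1) + m by ring, show p + m - 1 = (p - 1) + m by ring,
      hα.period, hα.period, hβ.period, hβ.period, hγ.period, max_sub_sub_right, min_sub_sub_right]
    ring

lemma sum_range_sub_one {g : ℤ → ℤ} (m : ℕ) :
    ∑ p ∈ Finset.range m, (g ((p : ℤ) - 1) - g p) = g (-1) - g ((m : ℤ) - 1) := by
  induction m with
  | zero => simp
  | succ m ih => rw [Finset.sum_range_succ, ih]; push_cast; ring_nf

/-- As `max + min` is the sum, the reflection exchanges the sizes of the two strips; the index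
shifts by one contribute `n - m` twice, with opposite signs. -/
lemma size_benderKnuth (hα : IsCyl m n α) (hβ : IsCyl m n β) :
    size m (benderKnuth α γ β) = size m α + size m β - size m γ := by
  have e1 := sum_range_sub_one (g := fun p => min (α p) (β (p + 1))) m
  have e2 := sum_range_sub_one (g := fun p => β (p + 1)) m
  have e3 := hα.period (-1)
  have e4 := hβ.period 0
  rw [show -1 + (m : ℤ) = m - 1 by ring] at e3
  rw [zero_add] at e4
  simp only [sub_add_cancel, show (-1 : ℤ) + 1 = 0 by norm_num] at e1 e2
  rw [e3, e4, min_sub_sub_right] at e1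
  rw [e4] at e2
  have e5 : ∑ p ∈ Finset.range m, (max (α p) (β (p + 1)) + min (α p) (β (p + 1))) =
      ∑ p ∈ Finset.range m, (α p + β (p + 1)) :=
    Finset.sum_congr rfl fun p _ => max_add_min _ _
  unfold size benderKnuth
  simp only [Finset.sum_sub_distrib, Finset.sum_add_distrib] at *
  linarith

end BenderKnuth

/-- The chains `α = γ 0 ⊆ γ 1 ⊆ ⋯ ⊆ γ (M + 1) = β` of horizontal strips of the sizes `a 0, …, a M`,
encoded as functions on `ℕ` which are constant from `M + 1` on. -/
def stripChains (m n : ℕ) {M : ℕ} (α β : ℤ → ℤ) (a : Fin (M + 1) → ℕ) : Set (ℕ → ℤ → ℤ) :=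
  {γ | γ 0 = α ∧ (∀ k, M + 1 ≤ k → γ k = β) ∧ (∀ k, IsCyl m n (γ k)) ∧
    ∀ k : Fin (M + 1), Strip (γ k) (γ (k + 1)) ∧ size m (γ (k + 1)) = size m (γ k) + a k}

/-- Apply the Bender–Knuth reflection to member `i + 1` of a chain. -/
def chainSwap (i : ℕ) (γ : ℕ → ℤ → ℤ) : ℕ → ℤ → ℤ :=
  Function.update γ (i + 1) (benderKnuth (γ i) (γ (i + 1)) (γ (i + 2)))

lemma chainSwap_chainSwap (i : ℕ) (γ : ℕ → ℤ → ℤ) : chainSwap i (chainSwap i γ) = γ := by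
  simp [chainSwap, benderKnuth_benderKnuth]

lemma chainSwap_mem {M : ℕ} {α β : ℤ → ℤ} {a : Fin (M + 1) → ℕ} {γ : ℕ → ℤ → ℤ} (i : Fin M)
    (h : γ ∈ stripChains m n α β a) :
    chainSwap i γ ∈ stripChains m n α β (a ∘ Equiv.swap i.castSucc i.succ) := by
  obtain ⟨h0, hM, hc, hs⟩ := h
  have s1 := hs i.castSucc
  have s2 := hs i.succ
  simp only [Fin.val_castSucc, Fin.val_succ, add_assoc, one_add_one_eq_two] at s1 s2
  have e0 : ∀ k, k ≠ (i : ℕ) + 1 → chainSwap i γ k = γ k := fun k hk =>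
    Function.update_of_ne hk _ _
  have e1 : chainSwap i γ (i + 1) = benderKnuth (γ i) (γ (i + 1)) (γ (i + 2)) :=
    Function.update_self _ _ _
  refine ⟨by rw [e0 0 (by omega), h0], fun k hk => by rw [e0 k (by omega), hM k hk],
    fun k => ?_, fun k => ?_⟩
  · by_cases hk : k = i + 1
    · rw [hk, e1]; exact isCyl_benderKnuth (hc _) (hc _) (hc _) s1.1 s2.1
    · rw [e0 k hk]; exact hc k
  · have hsize := size_benderKnuth (γ := γ (i + 1)) (hc i) (hc (i + 2))
    by_cases k1 : k = i.castSucc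
    · subst k1
      simp only [Fin.val_castSucc, Function.comp, Equiv.swap_apply_left]
      rw [e1, e0 i (by omega)]
      exact ⟨strip_benderKnuth s1.1 s2.1, by rw [hsize]; omega⟩
    by_cases k2 : k = i.succ
    · subst k2
      simp only [Fin.val_succ, Function.comp, Equiv.swap_apply_right, add_assoc,
        one_add_one_eq_two]
      rw [e1, e0 (i + 2) (by omega)]
      exact ⟨benderKnuth_strip s1.1 s2.1, by rw [hsize]; omega⟩
    · have k1' : (k : ℕ) ≠ i := fun h => k1 (Fin.ext h)
      have k2' : (k : ℕ) ≠ i + 1 := fun h => k2 (Fin.ext h)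
      rw [Function.comp, Equiv.swap_apply_of_ne_of_ne k1 k2, e0 k k2', e0 (k + 1) (by omega)]
      exact hs k

/-- The number of chains of horizontal strips does not depend on the order of the sizes. -/
lemma card_stripChains_comp {M : ℕ} {α β : ℤ → ℤ} (σ : Equiv.Perm (Fin (M + 1)))
    (a : Fin (M + 1) → ℕ) :
    Nat.card (stripChains m n α β (a ∘ σ)) = Nat.card (stripChains m n α β a) := by
  have hσ : σ ∈ Submonoid.closure
      (Set.range fun i : Fin M => Equiv.swap i.castSucc i.succ) := by
    rw [Equiv.Perm.mclosure_swap_castSucc_succ]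
    trivial
  induction hσ using Submonoid.closure_induction generalizing a with
  | mem _ h =>
    obtain ⟨i, rfl⟩ := h
    refine Nat.card_congr ⟨fun γ => ⟨chainSwap i γ, ?_⟩, fun γ => ⟨chainSwap i γ,
      chainSwap_mem i γ.2⟩, fun γ => Subtype.ext (chainSwap_chainSwap i _),
      fun γ => Subtype.ext (chainSwap_chainSwap i _)⟩
    have := chainSwap_mem i γ.2
    rwa [Function.comp_assoc, ← Equiv.coe_trans, ← Equiv.Perm.mul_def, Equiv.swap_mul_self,
      Equiv.Perm.coe_one, Function.comp_id] at this
  | one => rfl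
  | mul σ τ _ _ h1 h2 =>
    rw [Equiv.Perm.coe_mul, ← Function.comp_assoc, h2, h1]

/-! ### Cyclically decreasing decompositions -/

/-- The element whose reduced words add the boxes of `β / α` to `α`; it is `1` if there is none. -/
noncomputable def skewElement (m n : ℕ) (α β : ℤ → ℤ) : AffineSym n :=
  open Classical in if h : ∃ w : AffineSym n, NilActs m w α β then h.choose else 1

lemma NilActs.skewElement_eq {α β : ℤ → ℤ} {w : AffineSym n} (hm : 0 < m) (hmn : m < n)
    (hα : IsCyl m n α) (h : NilActs m w α β) : skewElement m n α β = w := by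
  have he : ∃ w : AffineSym n, NilActs m w α β := ⟨w, h⟩
  rw [skewElement, dif_pos he]
  exact he.choose_spec.eq hm hmn hα h

lemma nilActs_one (α : ℤ → ℤ) : NilActs m (1 : AffineSym n) α α :=
  ⟨[], ⟨by simp [CoxeterSystem.IsReduced], by simp⟩, rfl⟩

lemma prod_range_eq {G : Type*} [Monoid G] {f : ℕ → G} {A B : ℕ} (hA : ∀ k, A ≤ k → f k = 1)
    (hB : ∀ k, B ≤ k → f k = 1) :
    ((List.range A).map f).prod = ((List.range B).map f).prod := by
  have key : ∀ C, (∀ k, C ≤ k → f k = 1) → ∀ D,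
      ((List.range (C + D)).map f).prod = ((List.range C).map f).prod := by
    intro C hC D
    induction D with
    | zero => rfl
    | succ D ih =>
      rw [← add_assoc, List.range_succ, List.map_append, List.prod_append, ih]
      simp [hC (C + D) (by omega)]
  rw [← key A hA B, ← key B hB A, add_comm]

lemma length_prod_range_le (f : ℕ → AffineSym n) (N : ℕ) :
    (cox n).length ((List.range N).map f).prod ≤ ∑ k ∈ Finset.range N, (cox n).length (f k) := by
  induction N with
  | zero => simp
  | succ N ih =>
    rw [List.range_succ, List.map_append, List.prod_append, Finset.sum_range_succ]
    refine ((cox n).length_mul_le _ _).trans ?_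
    simpa using ih

/-- A length-additive factorization of an element which acts gives a chain of sequences. -/
lemma NilActs.exists_chain {α β : ℤ → ℤ} (hm : 0 < m) (hn : 3 ≤ n) (hα : IsCyl m n α)
    (f : ℕ → AffineSym n) (N : ℕ) (h : NilActs m ((List.range N).map f).prod α β)
    (hl : ∑ k ∈ Finset.range N, (cox n).length (f k) =
      (cox n).length ((List.range N).map f).prod) :
    ∃ δ : ℕ → ℤ → ℤ, δ 0 = β ∧ (∀ k, N ≤ k → δ k = α) ∧ (∀ k, IsCyl m n (δ k)) ∧
      ∀ k < N, NilActs m (f k) (δ (k + 1)) (δ k) := by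
  induction N generalizing α with
  | zero =>
    have := h.unique hn hα (nilActs_one α)
    exact ⟨fun _ => α, this.symm, fun _ _ => rfl, fun _ => hα, by simp⟩
  | succ N ih =>
    have h1 := length_prod_range_le f N
    rw [List.range_succ, List.map_append, List.prod_append, List.map_singleton,
      List.prod_singleton] at h hl
    rw [Finset.sum_range_succ] at hl
    have h2 := (cox n).length_mul_le ((List.range N).map f).prod (f N)
    obtain ⟨γ, h3, h4⟩ := h.exists_of_mul hm hn hα (by omega)
    obtain ⟨δ, d0, dN, dc, ds⟩ := ih (h3.isCyl hα) h4 (by omega)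
    refine ⟨fun k => if k ≤ N then δ k else α, by simpa using d0, fun k hk => if_neg (by omega),
      fun k => ?_, fun k hk => ?_⟩
    · dsimp only
      split_ifs
      exacts [dc k, hα]
    · dsimp only
      rw [if_pos (show k ≤ N by omega)]
      split_ifs with hk'
      · exact ds k (by omega)
      · rw [show k = N by omega, dN N le_rfl]
        exact h3

/-- Cyclically decreasing decompositions correspond to chains of horizontal strips. As the last
factor acts first, the sizes of the strips appear in reversed order. -/
lemma card_decompositions {M : ℕ} {α β : ℤ → ℤ} {w : AffineSym n} (hm : 0 < m) (hmn : m < n)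
    (hn : 3 ≤ n) (hα : IsCyl m n α) (hw : NilActs m w α β) (a : ℕ → ℕ)
    (ha : ∀ k, M + 1 ≤ k → a k = 0) :
    Nat.card (stripChains m n α β fun k : Fin (M + 1) => a k.rev) =
      Nat.card {f : ℕ → AffineSym n //
        IsCycDecDecomposition w f ∧ ∀ k, (cox n).length (f k) = a k} := by
  -- the truncated differences make `F γ k = 1` for `M < k`
  set F : (ℕ → ℤ → ℤ) → ℕ → AffineSym n := fun γ k =>
    skewElement m n (γ (M - k)) (γ (M + 1 - k)) with hF
  have hFact : ∀ γ ∈ stripChains m n α β fun k : Fin (M + 1) => a k.rev, ∀ k,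
      IsCycDec (F γ k) ∧ NilActs m (F γ k) (γ (M - k)) (γ (M + 1 - k)) ∧
      (cox n).length (F γ k) = a k := by
    rintro γ ⟨g0, gM, gc, gs⟩ k
    have hst : Strip (γ (M - k)) (γ (M + 1 - k)) ∧
        size m (γ (M + 1 - k)) = size m (γ (M - k)) + a k := by
      by_cases hk : k ≤ M
      · have := gs ⟨M - k, by omega⟩
        simp only [Fin.rev, show M - k + 1 = M + 1 - k by omega,
          show M + 1 - (M + 1 - k) = k by omega] at this
        exact this
      · rw [show M - k = 0 by omega, show M + 1 - k = 0 by omega, ha k (by omega)]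
        exact ⟨fun p => ⟨le_rfl, (gc 0).anti (by omega)⟩, by simp⟩
    obtain ⟨v, hv1, hv2⟩ := hst.1.exists_isD hm hn (gc _) (gc _)
    have he : F γ k = v := hv2.skewElement_eq hm hmn (gc _)
    rw [he]
    refine ⟨hv1, hv2, ?_⟩
    have := hv2.size_eq hm
    omega
  have hFmem : ∀ γ ∈ stripChains m n α β fun k : Fin (M + 1) => a k.rev,
      IsCycDecDecomposition w (F γ) ∧ ∀ k, (cox n).length (F γ k) = a k := by
    intro γ hγ
    have hact := hFact γ hγ
    obtain ⟨g0, gM, gc, gs⟩ := hγ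
    have hprod : ∀ K ≤ M + 1,
        NilActs m ((List.range K).map (F γ)).prod (γ (M + 1 - K)) β ∧
        (∑ k ∈ Finset.range K, (cox n).length (F γ k) : ℕ) + size m (γ (M + 1 - K)) =
          size m β := by
      intro K
      induction K with
      | zero =>
        intro _
        rw [Nat.sub_zero, gM _ le_rfl]
        exact ⟨nilActs_one β, by simp⟩
      | succ K ih =>
        intro hK
        obtain ⟨ih1, ih2⟩ := ih (by omega)
        have h1 := (hact K).2.1
        rw [show M + 1 - (K + 1) = M - K by omega, List.range_succ, List.map_append,
          List.prod_append, List.map_singleton, List.prod_singleton, Finset.sum_range_succ]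
        refine ⟨h1.mul hm hn (gc _) ih1, ?_⟩
        have := h1.size_eq hm
        push_cast at ih2 ⊢
        omega
    obtain ⟨h1, h2⟩ := hprod (M + 1) le_rfl
    rw [Nat.sub_self, g0] at h1 h2
    have h3 := h1.eq hm hmn hα hw
    refine ⟨⟨fun k => (hact k).1, M + 1, fun k hk => ?_, h3, ?_⟩, fun k => (hact k).2.2⟩
    · rw [← (cox n).length_eq_zero_iff, (hact k).2.2, ha k hk]
    · have := hw.size_eq hm
      omega
  refine Nat.card_congr (Equiv.ofBijective (fun γ => ⟨F γ, hFmem γ γ.2⟩) ⟨?_, ?_⟩)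
  · rintro ⟨γ, hγ⟩ ⟨γ', hγ'⟩ h
    have hFF : F γ = F γ' := congrArg Subtype.val h
    refine Subtype.ext (funext fun j => ?_)
    change γ j = γ' j
    have h1 := hFact γ hγ
    have h2 := hFact γ' hγ'
    obtain ⟨g0, gM, gc, gs⟩ := hγ
    obtain ⟨g0', gM', gc', gs'⟩ := hγ'
    have : ∀ j ≤ M + 1, γ j = γ' j := by
      clear j
      intro j
      induction j with
      | zero => intro _; rw [g0, g0']
      | succ j ih =>
        intro hj
        have e1 := (h1 (M - j)).2.1
        have e2 := (h2 (M - j)).2.1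
        rw [show M - (M - j) = j by omega, show M + 1 - (M - j) = j + 1 by omega] at e1 e2
        rw [← hFF, ← ih (by omega)] at e2
        exact e1.unique hn (gc j) e2
    rcases le_total j (M + 1) with hj | hj
    · rw [this j hj]
    · rw [gM j hj, gM' j hj]
  · rintro ⟨f, ⟨hf, N, hN, hprod, hsum⟩, hlen⟩
    have hone : ∀ k, M + 1 ≤ k → f k = 1 := fun k hk => by
      rw [← (cox n).length_eq_zero_iff, hlen k, ha k hk]
    rw [prod_range_eq hN hone] at hprod
    have hsum' : ∑ k ∈ Finset.range (M + 1), (cox n).length (f k) = (cox n).length w := by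
      have key : ∀ A, (∀ k, A ≤ k → f k = 1) → ∀ B,
          ∑ k ∈ Finset.range (A + B), (cox n).length (f k) =
            ∑ k ∈ Finset.range A, (cox n).length (f k) := fun A hA B => by
        rw [Finset.sum_range_add, Finset.sum_eq_zero (s := Finset.range B), add_zero]
        intro k _
        rw [hA _ (by omega), CoxeterSystem.length_one]
      rw [← hsum, ← key N hN (M + 1), ← key (M + 1) hone N, add_comm]
    subst hprod
    obtain ⟨δ, d0, dM, dc, ds⟩ := hw.exists_chain hm hn hα f (M + 1) hsum'
    have hmem : (fun j => δ (M + 1 - j)) ∈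
        stripChains m n α β fun k : Fin (M + 1) => a k.rev := by
      refine ⟨dM _ le_rfl, fun k hk => by simp only [Nat.sub_eq_zero_of_le hk, d0],
        fun k => dc _, fun j => ?_⟩
      have h1 := ds (M - j) (by omega)
      rw [show M - (j : ℕ) + 1 = M + 1 - j by omega, show M - (j : ℕ) = M + 1 - (j + 1) by omega]
        at h1
      dsimp only
      obtain ⟨J, -, ω, hω, -, hωw⟩ := hf (M + 1 - (j + 1))
      refine ⟨(h1.wordActs hm hn (dc _) ⟨hω.isReduced hn, hωw⟩).strip hn (dc _) hω, ?_⟩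
      rw [h1.size_eq hm, hlen, Fin.val_rev]
    refine ⟨⟨_, hmem⟩, Subtype.ext ?_⟩
    funext k
    simp only [hF]
    by_cases hk : k ≤ M
    · rw [show M + 1 - (M - k) = k + 1 by omega, show M + 1 - (M + 1 - k) = k by omega]
      exact (ds k (by omega)).skewElement_eq hm hmn (dc _)
    · rw [show M - k = 0 by omega, show M + 1 - k = 0 by omega, hone k (by omega)]
      exact (nilActs_one _).skewElement_eq hm hmn (dc _)

/-! ### Tableaux -/

lemma box_eq_iff {i j i' j' : ℤ} :
    box m n i j = box m n i' j' ↔ ∃ k : ℤ, i' = i + k * m ∧ j' = j - k * ((n : ℤ) - m) := by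
  unfold box
  rw [QuotientAddGroup.eq, AddSubgroup.mem_zmultiples_iff]
  constructor
  · rintro ⟨k, hk⟩
    rw [Prod.ext_iff] at hk
    simp at hk
    exact ⟨-k, by linarith [hk.1], by linarith [hk.2]⟩
  · rintro ⟨k, rfl, rfl⟩
    refine ⟨-k, Prod.ext ?_ ?_⟩
    · simp
    · simp; ring

lemma IsCyl.le_iff_of_box_eq {γ : ℤ → ℤ} (h : IsCyl m n γ) {i j i' j' : ℤ}
    (he : box m n i j = box m n i' j') : j ≤ γ i ↔ j' ≤ γ i' := by
  obtain ⟨k, rfl, rfl⟩ := box_eq_iff.1 he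
  rw [h.add_mul]
  omega

lemma box_mem_diagram {α β : ℤ → ℤ} (hα : IsCyl m n α) (hβ : IsCyl m n β) {i j : ℤ} :
    box m n i j ∈ diagram m n β α ↔ α i < j ∧ j ≤ β i := by
  constructor
  · rintro ⟨i', j', he, h1, h2⟩
    exact ⟨not_le.1 fun h => not_le.2 h1 ((hα.le_iff_of_box_eq he).1 h),
      (hβ.le_iff_of_box_eq he).2 h2⟩
  · rintro ⟨h1, h2⟩
    exact ⟨i, j, rfl, h1, h2⟩

lemma exists_box_eq (c : Cyl m n) : ∃ i j, c = box m n i j := by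
  obtain ⟨⟨i, j⟩, rfl⟩ := QuotientAddGroup.mk_surjective c
  exact ⟨i, j, rfl⟩

lemma diagram_eq_image {α β : ℤ → ℤ} (hm : 0 < m) (hα : IsCyl m n α) (hβ : IsCyl m n β) :
    diagram m n β α = (fun x : (_ : ℕ) × ℤ => box m n x.1 x.2) ''
      ((Finset.range m).sigma fun i : ℕ => Finset.Ioc (α i) (β i) : Finset ((_ : ℕ) × ℤ)) := by
  ext c
  constructor
  · rintro ⟨i, j, rfl, h1, h2⟩
    obtain ⟨q, hq, hqi⟩ := exists_range_modEq hm i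
    obtain ⟨k, hk⟩ := hqi.symm.dvd
    have he : box m n i j = box m n q (j - k * ((n : ℤ) - m)) :=
      box_eq_iff.2 ⟨k, by linarith, rfl⟩
    have hmem := (box_mem_diagram hα hβ).2 ⟨h1, h2⟩
    rw [he, box_mem_diagram hα hβ] at hmem
    exact ⟨⟨q, _⟩, by
      simpa only [Finset.coe_sigma, Set.mem_sigma_iff, Finset.mem_coe, Finset.mem_Ioc] using
        ⟨hq, hmem⟩, he.symm⟩
  · rintro ⟨⟨q, j⟩, hx, rfl⟩
    simp only [Finset.coe_sigma, Set.mem_sigma_iff, Finset.mem_coe, Finset.mem_Ioc] at hx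
    exact (box_mem_diagram hα hβ).2 hx.2

lemma finite_diagram {α β : ℤ → ℤ} (hm : 0 < m) (hα : IsCyl m n α) (hβ : IsCyl m n β) :
    (diagram m n β α).Finite := by
  rw [diagram_eq_image hm hα hβ]
  exact (Finset.finite_toSet _).image _

lemma card_diagram {α β : ℤ → ℤ} (hm : 0 < m) (hα : IsCyl m n α) (hβ : IsCyl m n β)
    (h : ∀ i, α i ≤ β i) : (Nat.card (diagram m n β α) : ℤ) = size m β - size m α := by
  rw [Nat.card_coe_set_eq, diagram_eq_image hm hα hβ, Set.InjOn.ncard_image,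
    Set.ncard_coe_finset, Finset.card_sigma]
  · unfold size
    rw [← Finset.sum_sub_distrib]
    push_cast
    refine Finset.sum_congr rfl fun i _ => ?_
    rw [Int.card_Ioc, Int.toNat_of_nonneg (sub_nonneg.2 (h i))]
  · rintro ⟨q, j⟩ hx ⟨q', j'⟩ hx' he
    simp only [Finset.coe_sigma, Set.mem_sigma_iff, Finset.mem_coe] at hx hx'
    obtain ⟨k, hk, hj⟩ := box_eq_iff.1 he
    dsimp only at hk hj
    have hqq : q = q' := range_modEq_injective hx.1 hx'.1
      (Int.modEq_iff_dvd.2 ⟨k, by rw [hk]; ring⟩)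
    subst hqq
    have hk0 : k * m = 0 := by linarith
    rcases mul_eq_zero.1 hk0 with rfl | h0
    · have : j' = j := by simpa using hj
      rw [this]
    · omega

/-- The tableau `T` on `β / α` and the family `γ` of sequences determine each other: the boxes with
entries less than `k` are those of `γ k / α`. -/
def IsLevelFamily (m n : ℕ) {α β : ℤ → ℤ} (T : diagram m n β α → ℕ) (γ : ℕ → ℤ → ℤ) : Prop :=
  ∀ (i j : ℤ) (h : box m n i j ∈ diagram m n β α) (k : ℕ), T ⟨_, h⟩ < k ↔ j ≤ γ k i

section Level
variable {α β : ℤ → ℤ} {T : diagram m n β α → ℕ} {γ : ℕ → ℤ → ℤ}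

lemma IsLevelFamily.card_eq (hm : 0 < m) (hα : IsCyl m n α) (hβ : IsCyl m n β)
    (hT : IsLevelFamily m n T γ) (hc : ∀ k, IsCyl m n (γ k)) (hαγ : ∀ k i, α i ≤ γ k i)
    (hγβ : ∀ k i, γ k i ≤ β i) {k : ℕ} (hk : ∀ i, γ k i ≤ γ (k + 1) i) :
    (Nat.card {c // T c = k} : ℤ) = size m (γ (k + 1)) - size m (γ k) := by
  rw [← card_diagram hm (hc k) (hc (k + 1)) hk]
  have himg : Subtype.val '' {c | T c = k} = diagram m n (γ (k + 1)) (γ k) := by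
    ext c
    obtain ⟨i, j, rfl⟩ := exists_box_eq c
    rw [box_mem_diagram (hc k) (hc (k + 1))]
    constructor
    · rintro ⟨⟨c, hc'⟩, h1, rfl⟩
      have e1 := hT i j hc' k
      have e2 := hT i j hc' (k + 1)
      rw [Set.mem_ofPred_eq] at h1
      rw [h1] at e1 e2
      exact ⟨by simpa using e1, by simpa using e2⟩
    · rintro ⟨h1, h2⟩
      have hmem := (box_mem_diagram hα hβ).2
        ⟨(hαγ k i).trans_lt h1, h2.trans (hγβ (k + 1) i)⟩
      refine ⟨⟨_, hmem⟩, ?_, rfl⟩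
      have e1 := hT i j hmem k
      have e2 := hT i j hmem (k + 1)
      rw [Set.mem_ofPred_eq]
      omega
  rw [← himg, Nat.card_image_of_injective Subtype.val_injective]
  rfl

lemma IsLevelFamily.isSemistandard
    (hT : IsLevelFamily m n T γ) (hs : ∀ k i, γ (k + 1) (i + 1) ≤ γ k i) :
    IsSemistandard (diagram m n β α) T := by
  constructor
  · intro i j h h'
    have := (hT i (j + 1) h' (T ⟨_, h'⟩ + 1)).1 (Nat.lt_succ_self _)
    have h2 : T ⟨_, h⟩ < T ⟨_, h'⟩ + 1 := (hT i j h _).2 (by omega)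
    omega
  · intro i j h h'
    have := (hT (i + 1) j h' (T ⟨_, h'⟩ + 1)).1 (Nat.lt_succ_self _)
    exact (hT i j h _).2 (this.trans (hs _ _))

lemma IsLevelFamily.unique {γ' : ℕ → ℤ → ℤ} (hα : IsCyl m n α) (hβ : IsCyl m n β)
    (hT : IsLevelFamily m n T γ)
    (hT' : IsLevelFamily m n T γ') (h1 : ∀ k i, α i ≤ γ k i) (h2 : ∀ k i, γ k i ≤ β i)
    (h1' : ∀ k i, α i ≤ γ' k i) (h2' : ∀ k i, γ' k i ≤ β i) : γ = γ' := by
  have key : ∀ γ γ' : ℕ → ℤ → ℤ, IsLevelFamily m n T γ → IsLevelFamily m n T γ' →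
      (∀ k i, γ k i ≤ β i) → (∀ k i, α i ≤ γ' k i) → ∀ k i, γ k i ≤ γ' k i := by
    intro γ γ' hT hT' h2 h1' k i
    by_contra! h
    have hmem := (box_mem_diagram hα hβ).2 ⟨(h1' k i).trans_lt h, h2 k i⟩
    exact not_le.2 h ((hT' i _ hmem k).1 ((hT i _ hmem k).2 le_rfl))
  funext k i
  exact le_antisymm (key γ γ' hT hT' h2 h1' k i) (key γ' γ hT' hT h2' h1 k i)

end Level

lemma exists_threshold {a b : ℤ} (hab : a ≤ b) (P : ℤ → Prop)
    (hP : ∀ j, a < j → j + 1 ≤ b → P (j + 1) → P j) :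
    ∃ g, a ≤ g ∧ g ≤ b ∧ ∀ j, a < j → j ≤ b → (P j ↔ j ≤ g) := by
  induction b, hab using Int.leInduction with
  | base => exact ⟨a, le_rfl, le_rfl, fun j h h' => by omega⟩
  | succ b hab ih =>
    obtain ⟨g, h1, h2, h3⟩ := ih fun j h h' => hP j h (by omega)
    by_cases hb : P (b + 1)
    · refine ⟨b + 1, by omega, le_rfl, fun j h h' => ⟨fun _ => h', fun _ => ?_⟩⟩
      rcases h'.eq_or_lt with rfl | h'
      · exact hb
      · have : P b := hP b (by omega) le_rfl hb
        have := (h3 b (by omega) le_rfl).1 this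
        exact (h3 j h (by omega)).2 (by omega)
    · refine ⟨g, h1, by omega, fun j h h' => ?_⟩
      rcases h'.eq_or_lt with rfl | h'
      · exact ⟨fun h => absurd h hb, fun h => by omega⟩
      · exact h3 j h (by omega)

/-- The boxes of a semistandard tableau with entries less than `k` form a cylindric shape. -/
lemma exists_isLevelFamily {α β : ℤ → ℤ} (hα : IsCyl m n α) (hβ : IsCyl m n β)
    (hle : ∀ i, α i ≤ β i) {T : diagram m n β α → ℕ}
    (hT : IsSemistandard (diagram m n β α) T) :
    ∃ γ : ℕ → ℤ → ℤ, IsLevelFamily m n T γ ∧ (∀ k i, α i ≤ γ k i) ∧ (∀ k i, γ k i ≤ β i) ∧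
      (∀ k, IsCyl m n (γ k)) ∧ ∀ k i, γ (k + 1) (i + 1) ≤ γ k i := by
  have hex : ∀ (k : ℕ) (i : ℤ), ∃ g, α i ≤ g ∧ g ≤ β i ∧ ∀ j, α i < j → j ≤ β i →
      ((∃ h : box m n i j ∈ diagram m n β α, T ⟨_, h⟩ < k) ↔ j ≤ g) := by
    intro k i
    refine exists_threshold (hle i) _ ?_
    rintro j h1 h2 ⟨h, hlt⟩
    have hmem := (box_mem_diagram hα hβ).2 ⟨h1, (show j ≤ β i by omega)⟩
    exact ⟨hmem, (hT.1 i j hmem h).trans_lt hlt⟩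
  choose γ g1 g2 g3 using hex
  have hlev : IsLevelFamily m n T γ := by
    intro i j h k
    have h' := (box_mem_diagram hα hβ).1 h
    rw [← g3 k i j h'.1 h'.2]
    exact ⟨fun hlt => ⟨h, hlt⟩, fun ⟨_, hlt⟩ => hlt⟩
  have hper : ∀ k i, γ k (i + m) = γ k i - ((n : ℤ) - m) := by
    -- the shifted family is a level family as well
    have := IsLevelFamily.unique (γ' := fun k i => γ k (i + m) + ((n : ℤ) - m)) hα hβ hlev
      (fun i j h k => by
        have he : box m n i j = box m n (i + m) (j - ((n : ℤ) - m)) :=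
          box_eq_iff.2 ⟨1, by ring, by ring⟩
        have h2 := hlev (i + m) (j - ((n : ℤ) - m)) (he ▸ h) k
        simp only [← he] at h2
        rw [h2]
        dsimp only
        omega) g1 g2
      (fun k i => by have := g1 k (i + m); rw [hα.period] at this; omega)
      (fun k i => by have := g2 k (i + m); rw [hβ.period] at this; omega)
    intro k i
    have := congrFun (congrFun this k) i
    omega
  have hcol : ∀ k i, γ (k + 1) (i + 1) ≤ γ k i := by
    intro k i
    by_contra! h
    have a1 : α (i + 1) ≤ α i := hα.anti (by omega)
    have b1 : β (i + 1) ≤ β i := hβ.anti (by omega)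
    have e1 := g1 k i
    have e2 := g2 (k + 1) (i + 1)
    have m1 := (box_mem_diagram hα hβ (i := i) (j := γ (k + 1) (i + 1))).2 ⟨by omega, by omega⟩
    have m2 := (box_mem_diagram hα hβ (i := i + 1) (j := γ (k + 1) (i + 1))).2
      ⟨by omega, by omega⟩
    have h1 := hT.2 _ _ m1 m2
    have h2 := (hlev _ _ m2 (k + 1)).2 le_rfl
    have h3 := mt (hlev _ _ m1 k).1 (by omega)
    omega
  have hmono : ∀ k i, γ k i ≤ γ (k + 1) i := by
    intro k i
    by_contra! h
    have m1 := (box_mem_diagram hα hβ (i := i) (j := γ k i)).2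
      ⟨(g1 (k + 1) i).trans_lt h, g2 k i⟩
    have h1 := (hlev _ _ m1 k).2 le_rfl
    have h2 := mt (hlev _ _ m1 (k + 1)).1 (by omega)
    omega
  exact ⟨γ, hlev, g1, g2, fun k => ⟨antitone_int_of_succ_le fun i => (hmono k _).trans (hcol k i),
    hper k⟩, hcol⟩

/-- The tableau whose entries less than `k` fill `γ k / α`. -/
noncomputable def levelTableau (m n : ℕ) (α β : ℤ → ℤ) (γ : ℕ → ℤ → ℤ) :
    diagram m n β α → ℕ :=
  fun c => sInf {k | ∃ i j, c.1 = box m n i j ∧ j ≤ γ (k + 1) i}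

lemma isLevelFamily_levelTableau {α β : ℤ → ℤ} {γ : ℕ → ℤ → ℤ} {M : ℕ} (hα : IsCyl m n α)
    (hβ : IsCyl m n β) (h0 : γ 0 = α) (hM : γ (M + 1) = β) (hc : ∀ k, IsCyl m n (γ k))
    (hmono : Monotone γ) : IsLevelFamily m n (levelTableau m n α β γ) γ := by
  intro i j h k
  obtain ⟨h1, h2⟩ := (box_mem_diagram hα hβ).1 h
  have hset : {k | ∃ i' j', box m n i j = box m n i' j' ∧ j' ≤ γ (k + 1) i'} =
      {k | j ≤ γ (k + 1) i} := by
    ext k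
    constructor
    · rintro ⟨i', j', he, hle⟩
      exact ((hc _).le_iff_of_box_eq he).2 hle
    · exact fun hle => ⟨i, j, rfl, hle⟩
  simp only [levelTableau, hset]
  constructor
  · intro hlt
    have hmem : sInf {k | j ≤ γ (k + 1) i} ∈ {k | j ≤ γ (k + 1) i} :=
      Nat.sInf_mem ⟨M, by rw [Set.mem_ofPred_eq, hM]; exact h2⟩
    exact le_trans hmem (hmono hlt i)
  · intro hle
    cases k with
    | zero => rw [h0] at hle; omega
    | succ k => exact Nat.lt_succ_of_le (Nat.sInf_le hle)

/-- Semistandard tableaux correspond to chains of horizontal strips. -/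
lemma card_tableaux {M : ℕ} {α β : ℤ → ℤ} (hm : 0 < m) (hα : IsCyl m n α) (hβ : IsCyl m n β)
    (hle : ∀ i, α i ≤ β i) (a : ℕ → ℕ) (ha : ∀ k, M + 1 ≤ k → a k = 0) :
    Nat.card (stripChains m n α β fun k : Fin (M + 1) => a k) =
      Nat.card {T : diagram m n β α → ℕ //
        IsSemistandard (diagram m n β α) T ∧ ∀ k, Nat.card {c // T c = k} = a k} := by
  have hfacts : ∀ γ ∈ stripChains m n α β fun k : Fin (M + 1) => a k,
      (∀ k, Strip (γ k) (γ (k + 1)) ∧ size m (γ (k + 1)) = size m (γ k) + a k) ∧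
      Monotone γ ∧ (∀ k i, α i ≤ γ k i) ∧ (∀ k i, γ k i ≤ β i) := by
    rintro γ ⟨g0, gM, gc, gs⟩
    have hst : ∀ k, Strip (γ k) (γ (k + 1)) ∧ size m (γ (k + 1)) = size m (γ k) + a k := by
      intro k
      by_cases hk : k < M + 1
      · exact gs ⟨k, hk⟩
      · rw [gM k (by omega), gM (k + 1) (by omega), ha k (by omega)]
        exact ⟨fun p => ⟨le_rfl, hβ.anti (by omega)⟩, by simp⟩
    have hmono : Monotone γ := monotone_nat_of_le_succ fun k p => ((hst k).1 p).1
    refine ⟨hst, hmono, fun k i => ?_, fun k i => ?_⟩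
    · rw [← g0]; exact hmono (Nat.zero_le k) i
    · rw [← gM (max k (M + 1)) (le_max_right _ _)]; exact hmono (le_max_left _ _) i
  have hlevel : ∀ γ ∈ stripChains m n α β fun k : Fin (M + 1) => a k,
      IsLevelFamily m n (levelTableau m n α β γ) γ := fun γ hγ =>
    isLevelFamily_levelTableau hα hβ hγ.1 (hγ.2.1 _ le_rfl) hγ.2.2.1 (hfacts γ hγ).2.1
  have hmem : ∀ γ ∈ stripChains m n α β fun k : Fin (M + 1) => a k,
      IsSemistandard (diagram m n β α) (levelTableau m n α β γ) ∧
        ∀ k, Nat.card {c // levelTableau m n α β γ c = k} = a k := by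
    intro γ hγ
    obtain ⟨f1, f2, f3, f4⟩ := hfacts γ hγ
    refine ⟨(hlevel γ hγ).isSemistandard fun k i => ?_, fun k => ?_⟩
    · have := ((f1 k).1 (i + 1)).2
      rwa [add_sub_cancel_right] at this
    · have := (hlevel γ hγ).card_eq hm hα hβ hγ.2.2.1 f3 f4 (k := k) fun i => ((f1 k).1 i).1
      rw [(f1 k).2] at this
      omega
  refine Nat.card_congr (Equiv.ofBijective
    (fun γ => ⟨levelTableau m n α β γ, hmem γ γ.2⟩) ⟨?_, ?_⟩)
  · rintro ⟨γ, hγ⟩ ⟨γ', hγ'⟩ h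
    have hTT : levelTableau m n α β γ = levelTableau m n α β γ' := congrArg Subtype.val h
    have h' := hlevel γ' hγ'
    rw [← hTT] at h'
    obtain ⟨-, -, f3, f4⟩ := hfacts γ hγ
    obtain ⟨-, -, f3', f4'⟩ := hfacts γ' hγ'
    exact Subtype.ext ((hlevel γ hγ).unique hα hβ h' f3 f4 f3' f4')
  · rintro ⟨T, hT, hcard⟩
    obtain ⟨γ, hlev, g1, g2, gc, gs⟩ := exists_isLevelFamily hα hβ hle hT
    have hfin : Finite (diagram m n β α) := finite_diagram hm hα hβ
    have hlt : ∀ c, T c < M + 1 := by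
      intro c
      by_contra! hc
      have h0 := hcard (T c)
      rw [ha _ hc, Finite.card_eq_zero_iff] at h0
      exact h0.false ⟨c, rfl⟩
    have e0 : γ 0 = α := by
      funext i
      refine le_antisymm (not_lt.1 fun h => ?_) (g1 0 i)
      have hb := (box_mem_diagram hα hβ).2 ⟨h, g2 0 i⟩
      exact absurd ((hlev i _ hb 0).2 le_rfl) (Nat.not_lt_zero _)
    have eM : ∀ k, M + 1 ≤ k → γ k = β := by
      intro k hk
      funext i
      refine le_antisymm (g2 k i) ?_
      rcases (hle i).eq_or_lt with h | h
      · rw [← h]; exact g1 k i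
      · have hb := (box_mem_diagram hα hβ).2 ⟨h, le_rfl⟩
        exact (hlev i _ hb k).1 ((hlt _).trans_le hk)
    have hmono : ∀ k i, γ k i ≤ γ (k + 1) i := by
      intro k i
      by_contra! h
      have hb := (box_mem_diagram hα hβ).2 ⟨(g1 (k + 1) i).trans_lt h, g2 k i⟩
      exact not_le.2 h ((hlev i _ hb _).1 (((hlev i _ hb k).2 le_rfl).trans (Nat.lt_succ_self k)))
    have hγ : γ ∈ stripChains m n α β fun k : Fin (M + 1) => a k := by
      refine ⟨e0, eM, gc, fun k => ⟨fun p => ⟨hmono k p, ?_⟩, ?_⟩⟩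
      · have := gs k (p - 1)
        rwa [sub_add_cancel] at this
      · have := hlev.card_eq hm hα hβ gc g1 g2 (k := k) (hmono k)
        rw [hcard] at this
        dsimp only
        omega
    refine ⟨⟨γ, hγ⟩, Subtype.ext ?_⟩
    funext ⟨c, hc⟩
    obtain ⟨i, j, rfl⟩ := exists_box_eq c
    have h1 : ∀ k, levelTableau m n α β γ ⟨_, hc⟩ < k ↔ T ⟨_, hc⟩ < k := fun k => by
      rw [hlevel γ hγ i j hc k, hlev i j hc k]
    exact le_antisymm (Nat.lt_succ_iff.1 ((h1 _).2 (Nat.lt_succ_self _)))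
      (Nat.lt_succ_iff.1 ((h1 _).1 (Nat.lt_succ_self _)))

end CylSchur

open CylSchur in
theorem corollary4p11 (m n : ℕ) (hm : 0 < m) (hmn : m < n) (hn : 3 ≤ n)
    (lam mu : BoxPartition m n) (d : ℕ) (hshape : ∀ i : ℤ, mu.shift 0 i ≤ lam.shift d i) :
    (∃! a : AffineSym n, IsPhiPreimage a lam d) ∧
    (∃! v : AffineSym n, IsPhiPreimage v mu 0) ∧
    ∀ a v : AffineSym n, IsPhiPreimage a lam d → IsPhiPreimage v mu 0 →
      a * v⁻¹ ∈ setA m n ∧ cylSchur lam d mu = affineStanley (a * v⁻¹) := by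
  refine ⟨existsUnique_isPhiPreimage hm hmn hn lam d, existsUnique_isPhiPreimage hm hmn hn mu 0,
    fun a v ha hv => ?_⟩
  have h0 := BoxPartition.shift_isCyl hm (BoxPartition.empty m n) hmn 0
  have hmu := mu.shift_isCyl hm hmn 0
  have hlam := lam.shift_isCyl hm hmn d
  obtain ⟨w, hw⟩ := exists_nilActs hm hmn hn hmu hlam hshape
  -- the path from the empty shape to `lam[d]` may be chosen to pass through `mu[0]`
  have hwv : a = w * v := ((isPhiPreimage_iff hm hmn hn).1 ha).eq hm hmn h0
    (NilActs.mul hm hn h0 ((isPhiPreimage_iff hm hmn hn).1 hv) hw)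
  rw [hwv, mul_inv_cancel_right]
  refine ⟨hw.mem_setA hm hn hmu, ?_⟩
  funext b
  obtain ⟨M, hM⟩ : ∃ M : ℕ, ∀ k, M + 1 ≤ k → b k = 0 := by
    refine ⟨b.support.sup id, fun k hk => ?_⟩
    by_contra hb
    have := Finset.le_sup (f := id) (Finsupp.mem_support_iff.2 hb)
    simp only [id] at this
    omega
  change ((Nat.card _ : ℕ) : ℤ) = ((Nat.card _ : ℕ) : ℤ)
  rw [← card_tableaux hm hmu hlam hshape b hM, ← card_decompositions hm hmn hn hmu hw b hM,
    ← card_stripChains_comp Fin.revPerm]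
  rfl
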